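/- **Conventions.** An efficient algorithm is a randomized polynomial-time algorithm (polynomial time on every input and for all coin tosses). *Learning.* $\mathrm{PARITY}$ is the hypothesis class of all functions $\chi_S:\{0,1\}^n\to\{0,1\}$, $\chi_S(x)=\bigoplus_{i\in S}x_i$, $S\subseteq[n]$, $n\ge 1$. For a distribution $D$ on $\{0,1\}^n\times\{0,1\}$ let $\mathrm{Err}_D(h)=\Pr_{(x,y)\sim D}(h(x)\neq y)$. For $\alpha\ge 1$, $\mathrm{PARITY}$ is *efficiently approximately agnostically learnable with approximation ratio $\alpha$* if there is a randomized algorithm which, given $n\ge1$, $\epsilon=1/s$ and $\delta=1/t$ ($s,t\ge 2$ integers) and an oracle producing independent samples from an arbitrary unknown distribution $D$ on $\{0,1\}^n\times\{0,1\}$, runs in time polynomial in $n,1/\epsilon,1/\delta$ and outputs a description of a hypothesis $h:\{0,1\}^n\to\{0,1\}$ (not necessarily a parity) that can be evaluated in time polynomial in $n,1/\epsilon,1/\delta$, such that with probability at least $1-\delta$, $\mathrm{Err}_D(h)\le\alpha\cdot\min_{S\subseteq[n]}\mathrm{Err}_D(\chi_S)+\epsilon$. *Random CSPs.* Let $P:\{0,1\}^K\to\{0,1\}$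 be a predicate, i.e. a non-constant function. A $P$-constraint on $n$ variables is $C(x)=P(x_{i_1}\oplus b_1,\dots,x_{i_K}\oplus b_K)$ with $b_l\in\{0,1\}$ and distinct $i_1,\dots,i_K\in[n]$; an instance $J$ is a sequence of $m$ such constraints, a random instance consists of $m$ independent constraints with uniformly random $(b,i)$, and $\mathrm{VAL}(J)$ is the maximal fraction of constraints of $J$ that one $x\in\{0,1\}^n$ satisfies. It is *easy to distinguish instances of value $\ge a$ from random instances with $n^d$ constraints* if there is an efficient algorithm which, on each instance with $n$ variables, $n^d$ constraints and value $\ge a$, answers "$\mathrm{VAL}(J)\ge a$" with probability $\ge 3/4$ over its coins, and which, with probability $1-o_n(1)$ over a random instance $J$ with $n$ variables and $n^d$ constraints, answers "$J$ is random" with probability $\ge 3/4$ over its coins. Otherwise it is *hard*. $\mathrm{VAR}_0(P)$ is the smallest cardinality of a set of variables of $P$ having an assignment that forces $P=0$ whatever the values of the other variables. $\mathrm{Uval}(P)=\max_{\mathcal D}\mathbb E_{x\sim\mathcal D}P(x)$, the maximum being over the distributions on $\{0,1\}^K$ under which every pair of coordinates is uniform on $\{0,1\}^2$. For a family $\mathcal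 P$ of predicates, $\mathrm{SRCSP}_2(\mathcal P)$ is the assertion: there is $f:\mathbb N\to\mathbb N$ such that for every integer $d\ge1$, every $P\in\mathcal P$ with $\mathrm{VAR}_0(P)\ge f(d)$ and every $\epsilon>0$, it is hard to distinguish instances of $\mathrm{CSP}(P)$ of value $\ge\mathrm{Uval}(P)-\epsilon$ from random instances with $n^d$ constraints. Part 2 of the SRCSP assumption is $\mathrm{SRCSP}_2(\text{all predicates})$. **Theorem.** For every constant $\alpha\ge1$ it is SRCSP-hard to approximately agnostically learn $\mathrm{PARITY}$ with approximation ratio $\alpha$: if $\mathrm{PARITY}$ is efficiently approximately agnostically learnable with approximation ratio $\alpha$, then part 2 of the SRCSP assumption is false. In fact, already $\mathrm{SRCSP}_2(\{P_K: K\ge 1\})$ is then false, where $P_K(x)=x_1\oplus\dots\oplus x_K$. -/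

import Mathlib

open scoped Topology

noncomputable section

namespace ParityHard

/-! ### Machine model: structured programs over finitely many stacks of bits

A program has access to registers `0, 1, 2, …`, each holding a stack of bits (only the finitely many
registers named in the program matter). All primitive operations act on the top of one stack and
cost one step, so programs without queries are multi-stack (equivalently, multi-tape) Turing
machines with structured control. `Q` is the type of queries that the program may ask; the answers
are random bit strings. With `Q = Empty` programs are deterministic, with `Q = Unit` the only query
is a coin toss, and learning algorithms may also ask for an example. -/

inductive Prog (Q : Type) : Type
  /-- do nothing -/
  | skip : Prog Q
  /-- push the bit `b` on register `r` -/
  | push (r : ℕ) (b : Bool) : Prog Q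
  /-- remove the top bit of register `r` (if there is one) -/
  | pop (r : ℕ) : Prog Q
  /-- ask the query `q`, and push the answer on register `r` -/
  | ask (r : ℕ) (q : Q) : Prog Q
  /-- sequential composition -/
  | seq (c d : Prog Q) : Prog Q
  /-- branch: register `r` is empty / has top bit `false` / has top bit `true` -/
  | branch (r : ℕ) (cEmpty cFalse cTrue : Prog Q) : Prog Q
  /-- repeat `c` as long as register `r` is nonempty -/
  | loop (r : ℕ) (c : Prog Q) : Prog Q

/-- The contents of the registers; the head of a list is the top of the stack. -/
abbrev Store : Type := ℕ → List Bool

/-- A configuration: the programs that remain to be executed, in order, and the store.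
The machine has halted if nothing remains to be executed. -/
abbrev Config (Q : Type) : Type := List (Prog Q) × Store

/-- An interpretation of the queries: the distribution of the answer to each of them; answers to
different calls are independent. -/
abbrev Oracle (Q : Type) : Type := Q → PMF (List Bool)

/-- One step of computation. A halted configuration does not change. -/
def step {Q : Type} (o : Oracle Q) : Config Q → PMF (Config Q)
  | ([], s) => PMF.pure ([], s)
  | (Prog.skip :: k, s) => PMF.pure (k, s)
  | (Prog.push r b :: k, s) => PMF.pure (k, Function.update s r (b :: s r))
  | (Prog.pop r :: k, s) => PMF.pure (k, Function.update s r (s r).tail)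
  | (Prog.ask r q :: k, s) => (o q).map fun a => (k, Function.update s r (a ++ s r))
  | (Prog.seq c d :: k, s) => PMF.pure (c :: d :: k, s)
  | (Prog.branch r cEmpty cFalse cTrue :: k, s) =>
      match s r with
      | [] => PMF.pure (cEmpty :: k, s)
      | false :: _ => PMF.pure (cFalse :: k, s)
      | true :: _ => PMF.pure (cTrue :: k, s)
  | (Prog.loop r c :: k, s) =>
      match s r with
      | [] => PMF.pure (k, s)
      | _ :: _ => PMF.pure (c :: Prog.loop r c :: k, s)

/-- The distribution of the configuration after `t` steps. -/
def runFor {Q : Type} (o : Oracle Q) : ℕ → Config Q → PMF (Config Q)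
  | 0, c => PMF.pure c
  | t + 1, c => (step o c).bind (runFor o t)

/-- The store that holds the given inputs in registers `0, 1, …`; all other registers are empty. -/
def load (inputs : List (List Bool)) : Store := fun r => inputs.getD r []

/-- The distribution of the configuration after running the program `A` for `t` steps on the given
inputs. -/
def exec {Q : Type} (o : Oracle Q) (A : Prog Q) (inputs : List (List Bool)) (t : ℕ) :
    PMF (Config Q) :=
  runFor o t ([A], load inputs)

/-- For every outcome of the random choices, `A` halts within `t` steps. -/
def HaltsWithin {Q : Type} (o : Oracle Q) (A : Prog Q) (inputs : List (List Bool)) (t : ℕ) :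
    Prop :=
  ∀ c ∈ (exec o A inputs t).support, c.1 = []

/-- The output of a halted configuration is the content of register `0`. -/
def output {Q : Type} (c : Config Q) : List Bool := c.2 0

/-- The natural number `n` in unary. -/
def unary (n : ℕ) : List Bool := List.replicate n true

/-- A fair coin toss. -/
def fairCoin : PMF (List Bool) := (PMF.uniformOfFintype Bool).map fun b => [b]

/-- The oracle of a randomized algorithm. -/
def coinOracle : Oracle Unit := fun _ => fairCoin

/-- The oracle of a deterministic algorithm. -/
def noOracle : Oracle Empty := fun q => q.elim

/-! ### Agnostic learning -/

/-- A hypothesis class over the instance spaces `{0,1}^n`. -/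
abbrev HypothesisClass : Type := ∀ n : ℕ, Set ((Fin n → Bool) → Bool)

/-- `Err_D(h) = Pr_{(x,y) ∼ D} (h(x) ≠ y)`. -/
def err {n : ℕ} (D : PMF ((Fin n → Bool) × Bool)) (h : (Fin n → Bool) → Bool) : ℝ :=
  (D.toOuterMeasure {z | h z.1 ≠ z.2}).toReal

/-- `Err_D(H) = min_{h ∈ H} Err_D(h)`. -/
def errClass {n : ℕ} (D : PMF ((Fin n → Bool) × Bool)) (H : Set ((Fin n → Bool) → Bool)) : ℝ :=
  sInf (err D '' H)

/-- The queries of a learning algorithm: toss a coin, or draw a labelled instance. -/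
inductive LearnQuery : Type
  | coin
  | draw

/-- The oracle of a learning algorithm for the distribution `D`. A labelled instance `(x, y)` is
delivered as the bit string `y x₁ … xₙ`. -/
def learnOracle {n : ℕ} (D : PMF ((Fin n → Bool) × Bool)) : Oracle LearnQuery
  | LearnQuery.coin => fairCoin
  | LearnQuery.draw => D.map fun z => z.2 :: List.ofFn z.1

/-- The bit string `w` describes the hypothesis `h`, in the sense that the deterministic program `E`
computes `h(x)` from `w` and `x` within `t` steps. -/
def Describes (E : Prog Empty) (t : ℕ) (w : List Bool) {n : ℕ} (h : (Fin n → Bool) → Bool) :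
    Prop :=
  ∀ x : Fin n → Bool,
    ∀ c ∈ (exec noOracle E [w, List.ofFn x] t).support, c.1 = [] ∧ output c = [h x]

/-- `H` is efficiently, approximately, agnostically (and possibly improperly) learnable with
approximation ratio `α`. The learning algorithm is `L`, the hypotheses it returns are evaluated by
`E`, and `p` bounds both running times. The error parameter is `ε = 1/s`, the confidence parameter
is `δ = 1/t`; the algorithm is given `n`, `s`, `t` in unary. -/
def EfficientlyAgnosticallyLearnable (H : HypothesisClass) (α : ℝ) : Prop :=
  ∃ (L : Prog LearnQuery) (E : Prog Empty) (p : Polynomial ℕ),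
    ∀ n s t : ℕ, 1 ≤ n → 2 ≤ s → 2 ≤ t → ∀ D : PMF ((Fin n → Bool) × Bool),
      let T : ℕ := p.eval (n + s + t)
      let inputs : List (List Bool) := [unary n, unary s, unary t]
      HaltsWithin (learnOracle D) L inputs T ∧
      (∀ c ∈ (exec (learnOracle D) L inputs T).support,
        ∃ h : (Fin n → Bool) → Bool, Describes E T (output c) h) ∧
      ENNReal.ofReal (1 - 1 / (t : ℝ)) ≤
        (exec (learnOracle D) L inputs T).toOuterMeasure
          {c | ∃ h : (Fin n → Bool) → Bool, Describes E T (output c) h ∧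
            err D h ≤ α * errClass D (H n) + 1 / (s : ℝ)}

/-- `χ_S(x) = ⊕_{i ∈ S} x_i`. -/
def chi {n : ℕ} (S : Finset (Fin n)) (x : Fin n → Bool) : Bool :=
  decide (Odd (S.filter fun i => x i = true).card)

/-- The class of all parity functions. -/
def PARITY : HypothesisClass := fun _ => Set.range chi

/-! ### Constraint satisfaction problems -/

/-- A `P`-constraint `C(x) = P(x_{i₁} ⊕ b₁, …, x_{i_K} ⊕ b_K)` on `n` variables, for a `K`-ary `P`:
the signs `b` and the distinct indices `i`. (Negation of a bit is the sign change of the `±1`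
convention.) -/
abbrev Constraint (K n : ℕ) : Type := (Fin K → Bool) × (Fin K ↪ Fin n)

/-- The value `C(x)` of a `P`-constraint under the assignment `x`. -/
def Constraint.eval {K n : ℕ} (P : (Fin K → Bool) → Bool) (C : Constraint K n)
    (x : Fin n → Bool) : Bool :=
  P fun l => xor (C.1 l) (x (C.2 l))

/-- An instance of `CSP(P)`, for a `K`-ary `P`, with `n` variables and `m` constraints. -/
abbrev Instance (K n m : ℕ) : Type := Fin m → Constraint K n

/-- `VAL(J)`: the maximal fraction of constraints that can be satisfied simultaneously. -/
def value {K n m : ℕ} (P : (Fin K → Bool) → Bool) (J : Instance K n m) : ℝ :=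
  ⨆ x : Fin n → Bool,
    ((Finset.univ.filter fun k : Fin m => (J k).eval P x = true).card : ℝ) / (m : ℝ)

/-- Encoding of an instance by a bit string: for each constraint and each of its `K` places, the
sign, followed by the index of the variable in unary and the delimiter `0`. -/
def encodeInstance {K n m : ℕ} (J : Instance K n m) : List Bool :=
  (List.ofFn fun k : Fin m =>
    (List.ofFn fun l : Fin K => (J k).1 l :: (unary ((J k).2 l) ++ [false])).flatten).flatten

/-- The probability, over its coins, that the algorithm `A` answers `b` on `J` (within `t` steps). -/
def answerProb {K n m : ℕ} (A : Prog Unit) (t : ℕ) (J : Instance K n m) (b : Bool) : ENNReal :=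
  (exec coinOracle A [unary n, encodeInstance J] t).toOuterMeasure
    {c | c.1 = [] ∧ output c = [b]}

/-- The problem `CSP^{a,rand}_{m(n)}(P)` is easy: some polynomial time randomized algorithm
distinguishes between instances of value at least `a` (answer `true`) and random instances
(answer `false`) with `n` variables and `m(n)` constraints. -/
def EasyToDistinguish {K : ℕ} (P : (Fin K → Bool) → Bool) (a : ℝ) (m : ℕ → ℕ) : Prop :=
  ∃ (A : Prog Unit) (p : Polynomial ℕ),
    (∀ n : ℕ, 1 ≤ n → ∀ J : Instance K n (m n),
      HaltsWithin coinOracle A [unary n, encodeInstance J] (p.eval n)) ∧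
    (∀ n : ℕ, 1 ≤ n → ∀ J : Instance K n (m n), a ≤ value P J →
      3 / 4 ≤ answerProb A (p.eval n) J true) ∧
    Filter.Tendsto
      (fun n : ℕ =>
        (({J : Instance K n (m n) | 3 / 4 ≤ answerProb A (p.eval n) J false}.ncard : ℕ) : ℝ) /
          (Nat.card (Instance K n (m n)) : ℝ))
      Filter.atTop (𝓝 1)

/-- The `0`-variability of `P`: the least cardinality of a set of variables that has an assignment
forcing `P = 0`. -/
def VAR0 {K : ℕ} (P : (Fin K → Bool) → Bool) : ℕ :=
  sInf {r : ℕ | ∃ (A : Finset (Fin K)) (a : Fin K → Bool), A.card = r ∧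
    ∀ x : Fin K → Bool, (∀ i ∈ A, x i = a i) → P x = false}

/-- A probability vector `w` on `{0,1}^K` is pairwise uniform: every pair of coordinates is
uniformly distributed. -/
def PairwiseUniform {K : ℕ} (w : (Fin K → Bool) → ℝ) : Prop :=
  ∀ i j : Fin K, i ≠ j → ∀ a b : Bool,
    ∑ x ∈ Finset.univ.filter (fun x : Fin K → Bool => x i = a ∧ x j = b), w x = 1 / 4

/-- `Uval(P)`: the maximum of `E_{x ∼ w} P(x)` over pairwise uniform distributions `w`. -/
def Uval {K : ℕ} (P : (Fin K → Bool) → Bool) : ℝ :=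
  sSup {v : ℝ | ∃ w ∈ stdSimplex ℝ (Fin K → Bool), PairwiseUniform w ∧
    v = ∑ x ∈ Finset.univ.filter (fun x : Fin K → Bool => P x = true), w x}

/-- The second part of the strong random CSP assumption, for the predicates (non-constant functions)
in the family `F`: there is `f` such that for each `P` in `F` with `VAR₀(P) ≥ f(d)` and each
`ε > 0`, it is hard to distinguish between instances of value at least `Uval(P) - ε` and random
instances with `n^d` constraints. -/
def SRCSPPart2For (F : ∀ K : ℕ, Set ((Fin K → Bool) → Bool)) : Prop :=
  ∃ f : ℕ → ℕ, ∀ d : ℕ, 1 ≤ d → ∀ (K : ℕ) (P : (Fin K → Bool) → Bool), P ∈ F K →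
    (∃ x, P x = true) → (∃ x, P x = false) → f d ≤ VAR0 P →
      ∀ ε : ℝ, 0 < ε → ¬ EasyToDistinguish P (Uval P - ε) (fun n => n ^ d)

/-- The second part of the strong random CSP assumption (for all predicates). -/
def SRCSPPart2 : Prop := SRCSPPart2For fun _ => Set.univ

/-- The family of the parity predicates `P_K(x) = x₁ ⊕ … ⊕ x_K`. -/
def parityPredicates : ∀ K : ℕ, Set ((Fin K → Bool) → Bool) := fun _ => {chi Finset.univ}

end ParityHard

end

noncomputable section

namespace ParityHard

/-! A constraint of the parity CSP is a linear equation over `ZMod 2`. Its places give the indicator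
vector of its variables as an unlabelled example, and its signs give the label `1 ⊕ b₁ ⊕ … ⊕ b_K`.
An assignment satisfies the constraint exactly when the parity over its support is correct on this
example (`eval_eq_true_iff`). The distinguisher runs the learner on random constraints of the
instance, then tests the returned hypothesis on all `m = n^d` constraints. It answers "high value"
if and only if fewer than a quarter of them are misclassified.

Instances of high value: for `K ≥ 3` the uniform distribution on odd strings is pairwise uniform, so
`Uval` is at least `1` (`one_le_Uval_chi`). With `ε = 1/(10α)` some parity errs on at most `m/(10α)`
constraints. The guarantee of the learner then leaves at most `m/10 + m/20 < m/4` errors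
(`badCount_lt`).

Random instances: the first sign makes every label a fair coin independent of the vector, so a fixed
hypothesis errs on fewer than `m/4` constraints with probability at most `(25/28)^m`
(`card_bad_le`). The running time of the learner bounds the length of its output by `B = O(n^(deg p
+ 1))`, where `p` is its time bound. This does not involve `m` apart from constants depending on
`d`. A union bound over the fewer than `2^(B+1)` descriptions shows that for `d = deg p + 2` almost
no instance is fitted by any possible output (`ncard_fit_le`, `tendsto_noFit`). Since `K ≤ VAR0` for
the parity of arity `K` (`le_VAR0_chi`), the arity can be chosen above `f d` after `d` has been
fixed.

With fair coins an exactly uniform index below `m` is not available in bounded time. The index is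
therefore uniform below a power of two `2^q` with `m ≤ 2^q ≤ 2^d m`, and excess indices yield the
zero vector with label `0`, on which every parity is correct. This rescales errors by the factor
`m/2^q ≥ 2^(-d)`, which a constant error parameter absorbs. The rest is an explicit program for the
reduction, with its exact output distribution and a polynomial time bound (`runs_reduction`,
`exists_reductionTime_le`). -/

/-! ### Compositional semantics of randomized programs. -/

theorem bind_congr_support {α β : Type*} {p : PMF α} {f g : α → PMF β}
    (h : ∀ a ∈ p.support, f a = g a) : p.bind f = p.bind g := by
  ext b
  rw [PMF.bind_apply, PMF.bind_apply]
  refine tsum_congr fun a => ?_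
  by_cases ha : a ∈ p.support
  · rw [h a ha]
  · rw [PMF.mem_support_iff, not_not] at ha
    simp [ha]

/-- Started in the store `s`, the programs in `k` (executed in order) terminate within `t` steps for
all coin tosses, and `ν` is the distribution of the resulting store. The formulation quantifies over
all continuations whose behaviour stabilises. -/
def Runs (k : List (Prog Unit)) (s : Store) (t : ℕ) (ν : PMF Store) : Prop :=
  ∀ (k' : List (Prog Unit)) (T : ℕ) (ρ : Store → PMF (Config Unit)),
    (∀ s' ∈ ν.support, ∀ T' ≥ T, runFor coinOracle T' (k', s') = ρ s') →
      ∀ T' ≥ T + t, runFor coinOracle T' (k ++ k', s) = ν.bind ρ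

theorem runFor_halted {Q : Type} (o : Oracle Q) (t : ℕ) (s : Store) :
    runFor o t ([], s) = PMF.pure ([], s) := by
  induction t with
  | zero => rfl
  | succ t ih => rw [runFor, step, PMF.pure_bind, ih]

namespace Runs

variable {k k₁ k₂ : List (Prog Unit)} {s s' : Store} {t t' t₁ t₂ : ℕ} {ν : PMF Store}
  {c d : Prog Unit}

theorem exec_eq {A : Prog Unit} {inputs : List (List Bool)} (h : Runs [A] (load inputs) t ν)
    (ht : t ≤ t') : exec coinOracle A inputs t' = ν.map fun s => ([], s) :=
  h [] 0 (fun s => PMF.pure ([], s)) (fun _ _ _ _ => runFor_halted _ _ _) t' (by omega)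

theorem mono (h : Runs k s t ν) (ht : t ≤ t') : Runs k s t' ν :=
  fun k' T ρ hρ T' hT' => h k' T ρ hρ T' (by omega)

theorem nil : Runs [] s 0 (PMF.pure s) := by
  intro k' T ρ hρ T' hT'
  rw [PMF.pure_bind]
  exact hρ s (by simp) T' (by omega)

/-- Composition is substitution of continuations: `k₂ ++ k'` is a continuation for `k₁` whose
behaviour stabilises after `T + t₂` steps. Quantifying over all sufficiently late times avoids
tracking running times that depend on the coins. -/
theorem append {ν' : Store → PMF Store} (h₁ : Runs k₁ s t₁ ν)
    (h₂ : ∀ s' ∈ ν.support, Runs k₂ s' t₂ (ν' s')) :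
    Runs (k₁ ++ k₂) s (t₁ + t₂) (ν.bind ν') := by
  intro k' T ρ hρ T' hT'
  rw [List.append_assoc, PMF.bind_bind]
  refine h₁ (k₂ ++ k') (T + t₂) _ (fun s' hs' T'' hT'' => ?_) T' (by omega)
  refine h₂ s' hs' k' T ρ (fun s'' hs'' => hρ s'' ?_) T'' hT''
  rw [PMF.mem_support_bind_iff]
  exact ⟨s', hs', hs''⟩

theorem cons {ν' : Store → PMF Store} (h₁ : Runs [c] s t₁ ν)
    (h₂ : ∀ s' ∈ ν.support, Runs k₂ s' t₂ (ν' s')) :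
    Runs (c :: k₂) s (t₁ + t₂) (ν.bind ν') :=
  append (k₁ := [c]) h₁ h₂

theorem of_step (hs : ∀ k', step coinOracle (c :: k', s) = PMF.pure (k₂ ++ k', s'))
    (h : Runs (k₂ ++ k) s' t ν) : Runs (c :: k) s (t + 1) ν := by
  intro k' T ρ hρ T' hT'
  obtain ⟨T'', rfl⟩ : ∃ T'', T' = T'' + 1 := ⟨T' - 1, by omega⟩
  rw [List.cons_append, runFor, hs, PMF.pure_bind, ← List.append_assoc]
  exact h k' T ρ hρ T'' (by omega)

theorem skip_cons (h : Runs k s t ν) : Runs (Prog.skip :: k) s (t + 1) ν :=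
  of_step (k₂ := []) (fun _ => rfl) h

theorem push_cons {r : ℕ} {b : Bool} (h : Runs k (Function.update s r (b :: s r)) t ν) :
    Runs (Prog.push r b :: k) s (t + 1) ν :=
  of_step (k₂ := []) (fun _ => rfl) h

theorem pop_cons {r : ℕ} (h : Runs k (Function.update s r (s r).tail) t ν) :
    Runs (Prog.pop r :: k) s (t + 1) ν :=
  of_step (k₂ := []) (fun _ => rfl) h

theorem seq_cons (h : Runs (c :: d :: k) s t ν) : Runs (Prog.seq c d :: k) s (t + 1) ν :=
  of_step (k₂ := [c, d]) (fun _ => rfl) h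

/-- The program that a branch on a register with content `l` selects. -/
def _root_.ParityHard.select {α : Type*} (l : List Bool) (x y z : α) : α :=
  match l with
  | [] => x
  | false :: _ => y
  | true :: _ => z

theorem branch_cons {r : ℕ} {e : Prog Unit} (h : Runs (select (s r) c d e :: k) s t ν) :
    Runs (Prog.branch r c d e :: k) s (t + 1) ν := by
  refine of_step (k₂ := [select (s r) c d e]) (s' := s) (fun k' => ?_) h
  rcases hr : s r with _ | ⟨_ | _, l⟩ <;> simp [step, hr, select]

theorem loop_nil {r : ℕ} (hr : s r = []) (h : Runs k s t ν) :
    Runs (Prog.loop r c :: k) s (t + 1) ν := by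
  refine of_step (k₂ := []) (s' := s) (fun k' => ?_) h
  simp [step, hr]

theorem loop_cons {r : ℕ} (hr : s r ≠ []) (h : Runs (c :: Prog.loop r c :: k) s t ν) :
    Runs (Prog.loop r c :: k) s (t + 1) ν := by
  refine of_step (k₂ := [c, Prog.loop r c]) (s' := s) (fun k' => ?_) h
  rcases hr' : s r with _ | ⟨b, l⟩
  · exact absurd hr' hr
  · simp [step, hr']

theorem ask (r : ℕ) : Runs [Prog.ask r ()] s 1
    (fairCoin.map fun a => Function.update s r (a ++ s r)) := by
  intro k' T ρ hρ T' hT'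
  obtain ⟨T'', rfl⟩ : ∃ T'', T' = T'' + 1 := ⟨T' - 1, by omega⟩
  rw [List.cons_append, List.nil_append, runFor, step, coinOracle, PMF.bind_map, PMF.bind_map]
  refine bind_congr_support fun a ha => ?_
  refine hρ _ ?_ _ (by omega)
  rw [PMF.mem_support_map_iff]
  exact ⟨a, ha, rfl⟩

theorem seq {ν' : Store → PMF Store} (h₁ : Runs [c] s t₁ ν)
    (h₂ : ∀ s' ∈ ν.support, Runs [d] s' t₂ (ν' s')) :
    Runs [Prog.seq c d] s (t₁ + t₂ + 1) (ν.bind ν') :=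
  seq_cons (cons h₁ h₂)

end Runs

/-- Deterministic termination within `t` steps. -/
def Det (c : Prog Unit) (s : Store) (t : ℕ) (s' : Store) : Prop := Runs [c] s t (PMF.pure s')

theorem Runs.seq_det {c d : Prog Unit} {s s' : Store} {t₁ t₂ : ℕ} {ν : PMF Store}
    (h₁ : Det c s t₁ s') (h₂ : Runs [d] s' t₂ ν) : Runs [Prog.seq c d] s (t₁ + t₂ + 1) ν := by
  have := Runs.seq (ν' := fun _ => ν) h₁ (t₂ := t₂) (d := d) (by simpa using h₂)
  simpa using this

/-- Here the remaining run is described for each random outcome `a`, not for each store `f a`. This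
matters because `f` need not be injective, so the outcome cannot be recovered from the store. -/
theorem Runs.cons_map {α : Type*} {c : Prog Unit} {k : List (Prog Unit)} {s : Store} {t₁ t₂ : ℕ}
    {ν : PMF α} {f : α → Store} {ν' : α → PMF Store}
    (h₁ : Runs [c] s t₁ (ν.map f)) (h₂ : ∀ a ∈ ν.support, Runs k (f a) t₂ (ν' a)) :
    Runs (c :: k) s (t₁ + t₂) (ν.bind ν') := by
  intro k' T ρ hρ T' hT'
  have key : ∀ a ∈ ν.support, ∀ T' ≥ T + t₂,
      runFor coinOracle T' (k ++ k', f a) = (ν' a).bind ρ := by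
    intro a ha
    refine h₂ a ha k' T ρ fun s' hs' => hρ s' ?_
    rw [PMF.mem_support_bind_iff]
    exact ⟨a, ha, hs'⟩
  -- The limiting behaviour is read off at time `T + t₂`. This depends only on the store, and `key`
  -- shows that it no longer changes and agrees with the description by any outcome that produces
  -- this store.
  have := h₁ (k ++ k') (T + t₂) (fun s' => runFor coinOracle (T + t₂) (k ++ k', s')) (by
    intro s' hs' T' hT'
    obtain ⟨a, ha, rfl⟩ := (PMF.mem_support_map_iff ..).1 hs'
    rw [key a ha _ hT', key a ha _ le_rfl]) T' (by omega)
  rw [List.cons_append, List.nil_append] at this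
  rw [List.cons_append, this, PMF.bind_map, PMF.bind_bind]
  exact bind_congr_support fun a ha => key a ha _ le_rfl

theorem Runs.seq_map {α : Type*} {c d : Prog Unit} {s : Store} {t₁ t₂ : ℕ} {ν : PMF α}
    {f : α → Store} {ν' : α → PMF Store}
    (h₁ : Runs [c] s t₁ (ν.map f)) (h₂ : ∀ a ∈ ν.support, Runs [d] (f a) t₂ (ν' a)) :
    Runs [Prog.seq c d] s (t₁ + t₂ + 1) (ν.bind ν') :=
  Runs.seq_cons (Runs.cons_map h₁ h₂)

theorem Runs.det_map {α : Type*} {c d : Prog Unit} {s : Store} {t₁ t₂ : ℕ} {ν : PMF α}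
    {f g : α → Store}
    (h₁ : Runs [c] s t₁ (ν.map f))
    (h₂ : ∀ a ∈ ν.support, Runs [d] (f a) t₂ (PMF.pure (g a))) :
    Runs [Prog.seq c d] s (t₁ + t₂ + 1) (ν.map g) :=
  Runs.seq_map h₁ h₂

namespace Det

variable {s s' s'' : Store} {t t' t₁ t₂ : ℕ} {c d : Prog Unit}

theorem mono (h : Det c s t s') (ht : t ≤ t') : Det c s t' s' := Runs.mono h ht

theorem seq (h₁ : Det c s t₁ s') (h₂ : Det d s' t₂ s'') :
    Det (Prog.seq c d) s (t₁ + t₂ + 1) s'' := Runs.seq_det h₁ h₂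

theorem cons {k : List (Prog Unit)} {ν : PMF Store} (h₁ : Det c s t₁ s') (h₂ : Runs k s' t₂ ν) :
    Runs (c :: k) s (t₁ + t₂) ν := by
  have := Runs.cons (ν' := fun _ => ν) h₁ (t₂ := t₂) (k₂ := k) (by simpa using h₂)
  simpa using this

theorem loop_nil {r : ℕ} (hr : s r = []) : Det (Prog.loop r c) s 1 s :=
  Runs.loop_nil hr Runs.nil

theorem loop_cons {r : ℕ} (hr : s r ≠ []) (h₁ : Det c s t₁ s')
    (h₂ : Det (Prog.loop r c) s' t₂ s'') : Det (Prog.loop r c) s (t₁ + t₂ + 1) s'' :=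
  Runs.loop_cons hr (cons h₁ h₂)

/-- A loop that runs through the stores `f 0, …, f N`. -/
theorem loop {r : ℕ} (f : ℕ → Store) (N : ℕ) (hr : ∀ i < N, f i r ≠ []) (hN : f N r = [])
    (hc : ∀ i < N, Det c (f i) t (f (i + 1))) :
    Det (Prog.loop r c) (f 0) (N * (t + 1) + 1) (f N) := by
  induction N generalizing f with
  | zero => exact (loop_nil hN).mono (by omega)
  | succ N ih =>
    have h := ih (fun i => f (i + 1)) (fun i hi => hr _ (by omega)) hN
      (fun i hi => hc _ (by omega))
    refine (loop_cons (hr 0 (by omega)) (hc 0 (by omega)) h).mono ?_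
    ring_nf
    omega

end Det

/-! ### Straight-line programs. -/

/-- The effect of a program without loops and queries. -/
def ev : Prog Unit → Store → Store
  | Prog.skip, s => s
  | Prog.push r b, s => Function.update s r (b :: s r)
  | Prog.pop r, s => Function.update s r (s r).tail
  | Prog.ask _ _, s => s
  | Prog.seq c d, s => ev d (ev c s)
  | Prog.branch r c d e, s => select (s r) (ev c s) (ev d s) (ev e s)
  | Prog.loop _ _, s => s

def Straight : Prog Unit → Prop
  | Prog.skip => True
  | Prog.push _ _ => True
  | Prog.pop _ => True
  | Prog.ask _ _ => False
  | Prog.seq c d => Straight c ∧ Straight d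
  | Prog.branch _ c d e => Straight c ∧ Straight d ∧ Straight e
  | Prog.loop _ _ => False

/-- A bound on the running time of a program without loops and queries. -/
def psize : Prog Unit → ℕ
  | Prog.seq c d => psize c + psize d + 1
  | Prog.branch _ c d e => max (psize c) (max (psize d) (psize e)) + 1
  | _ => 1

/-- Loop-free, query-free fragments are thereby verified by `simp` on `ev`, with an explicit
constant time bound. -/
theorem Det.straight {c : Prog Unit} (hc : Straight c) (s : Store) : Det c s (psize c) (ev c s) := by
  induction c generalizing s with
  | skip => exact Runs.skip_cons Runs.nil
  | push r b => exact Runs.push_cons Runs.nil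
  | pop r => exact Runs.pop_cons Runs.nil
  | ask r q => exact hc.elim
  | seq c d ihc ihd => exact (ihc hc.1 s).seq (ihd hc.2 _)
  | branch r c d e ihc ihd ihe =>
    refine Runs.branch_cons ?_
    have h₁ := ihc hc.1 s
    have h₂ := ihd hc.2.1 s
    have h₃ := ihe hc.2.2 s
    rcases hr : s r with _ | ⟨_ | _, l⟩
    · simp only [ev, hr, select]
      exact Det.mono h₁ (by omega)
    · simp only [ev, hr, select]
      exact Det.mono h₂ (by omega)
    · simp only [ev, hr, select]
      exact Det.mono h₃ (by omega)
  | loop r c => exact hc.elim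

/-! ### Simulation of programs with other queries -/

/-- The program that simulates a program with queries from `Q`: the registers are shifted by `12`,
and queries are replaced by calls of the subroutines `sub`. -/
def translate {Q : Type} (sub : ℕ → Q → Prog Unit) : Prog Q → Prog Unit
  | Prog.skip => Prog.skip
  | Prog.push r b => Prog.push (r + 12) b
  | Prog.pop r => Prog.pop (r + 12)
  | Prog.ask r q => sub r q
  | Prog.seq c d => Prog.seq (translate sub c) (translate sub d)
  | Prog.branch r c d e =>
      Prog.branch (r + 12) (translate sub c) (translate sub d) (translate sub e)
  | Prog.loop r c => Prog.loop (r + 12) (translate sub c)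

/-- The store with `P 0, …, P 11` in the first registers, followed by the store `s`. -/
def join (P : Fin 12 → List Bool) (s : Store) : Store :=
  fun r => if h : r < 12 then P ⟨r, h⟩ else s (r - 12)

@[simp] theorem join_add (P : Fin 12 → List Bool) (s : Store) (r : ℕ) :
    join P s (r + 12) = s r := by simp [join]

@[simp] theorem update_join_add (P : Fin 12 → List Bool) (s : Store) (r : ℕ) (l : List Bool) :
    Function.update (join P s) (r + 12) l = join P (Function.update s r l) := by
  funext i
  by_cases hi : i < 12
  · rw [Function.update_of_ne (by omega)]
    simp [join, hi]
  · obtain ⟨j, rfl⟩ : ∃ j, i = j + 12 := ⟨i - 12, by omega⟩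
    rw [join_add]
    by_cases hj : j = r
    · subst hj; simp
    · rw [Function.update_of_ne (by omega), join_add, Function.update_of_ne hj]

/-- Every simulated step costs at most `B`: ordinary instructions cost one step and queries cost one
subroutine call, which must leave the workspace `P` as it was. The oracle answers are reproduced
with their exact distribution, so the simulation is exact. Halting is needed at time `0`, where
nothing may remain to be executed. -/
theorem Runs.translate {Q : Type} {o : Oracle Q} {sub : ℕ → Q → Prog Unit}
    {P : Fin 12 → List Bool} {B : ℕ} (hB : 1 ≤ B)
    (hsub : ∀ r q s, Runs [sub r q] (join P s) B
      ((o q).map fun a => join P (Function.update s r (a ++ s r))))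
    (t : ℕ) (k : List (Prog Q)) (s : Store)
    (hhalt : ∀ c ∈ (runFor o t (k, s)).support, c.1 = []) :
    Runs (k.map (translate sub)) (join P s) (t * B)
      ((runFor o t (k, s)).map fun c => join P c.2) := by
  induction t generalizing k s with
  | zero =>
    have : k = [] := hhalt (k, s) (by simp [runFor])
    subst this
    simpa [runFor, PMF.pure_map] using Runs.nil (s := join P s)
  | succ t ih =>
    have hnext : ∀ c ∈ (step o (k, s)).support, Runs (c.1.map (ParityHard.translate sub))
        (join P c.2) (t * B) ((runFor o t c).map fun c => join P c.2) := by
      intro c hc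
      refine ih c.1 c.2 fun c' hc' => hhalt c' ?_
      rw [runFor, PMF.mem_support_bind_iff]
      exact ⟨c, hc, hc'⟩
    have htime : t * B + 1 ≤ (t + 1) * B := by rw [add_mul]; omega
    rcases k with _ | ⟨c, k⟩
    · rw [runFor_halted, PMF.pure_map]
      exact Runs.nil.mono (Nat.zero_le _)
    · rw [runFor]
      rcases c with _ | ⟨r, b⟩ | r | ⟨r, q⟩ | ⟨c, d⟩ | ⟨r, c, d, e⟩ | ⟨r, c⟩
      · simp only [step, PMF.pure_bind, PMF.mem_support_pure_iff, forall_eq] at hnext ⊢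
        exact (Runs.skip_cons hnext).mono htime
      · simp only [step, PMF.pure_bind, PMF.mem_support_pure_iff, forall_eq] at hnext ⊢
        refine (Runs.push_cons ?_).mono htime
        simpa using hnext
      · simp only [step, PMF.pure_bind, PMF.mem_support_pure_iff, forall_eq] at hnext ⊢
        refine (Runs.pop_cons ?_).mono htime
        simpa using hnext
      · rw [step, PMF.bind_map, PMF.map_bind]
        refine (Runs.cons_map (hsub r q s) fun a ha => ?_).mono (t := B + t * B)
          (by rw [add_mul]; omega)
        refine hnext _ ?_
        rw [step, PMF.mem_support_map_iff]
        exact ⟨a, ha, rfl⟩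
      · simp only [step, PMF.pure_bind, PMF.mem_support_pure_iff, forall_eq] at hnext ⊢
        exact (Runs.seq_cons hnext).mono htime
      · refine (Runs.branch_cons ?_).mono htime
        rcases hr : s r with _ | ⟨_ | _, l⟩ <;>
        · simp only [step, hr, PMF.pure_bind, PMF.mem_support_pure_iff, forall_eq] at hnext ⊢
          simpa [join_add, hr, select] using hnext
      · rcases hr : s r with _ | ⟨b, l⟩
        · simp only [step, hr, PMF.pure_bind, PMF.mem_support_pure_iff, forall_eq] at hnext ⊢
          exact (Runs.loop_nil (by simp [hr]) hnext).mono htime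
        · simp only [step, hr, PMF.pure_bind, PMF.mem_support_pure_iff, forall_eq] at hnext ⊢
          exact (Runs.loop_cons (by simp [hr]) hnext).mono htime

/-! ### Explicit workspace registers. -/

/-- The store whose first twelve registers are given explicitly. -/
def mem (a0 a1 a2 a3 a4 a5 a6 a7 a8 a9 a10 a11 : List Bool) (s : Store) : Store :=
  -- Roles in the reduction: `0` holds `n` zero bits, `1` the encoded instance, `2` a working copy
  -- that is consumed, `3` and `4` the current vector and label, `5` and `6` scratch, `7` a random
  -- index, `8` the number `q` of coins in unary, `9` the hypothesis. Registers `10` and `11`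
  -- finally count correct and wrong constraints; `10` is also the coin counter while sampling. The
  -- simulated programs live from `12` on.
  join ![a0, a1, a2, a3, a4, a5, a6, a7, a8, a9, a10, a11] s

section mem

variable (a0 a1 a2 a3 a4 a5 a6 a7 a8 a9 a10 a11 l : List Bool) (s : Store)

@[simp] theorem mem_apply_0 : mem a0 a1 a2 a3 a4 a5 a6 a7 a8 a9 a10 a11 s 0 = a0 := rfl
@[simp] theorem mem_apply_1 : mem a0 a1 a2 a3 a4 a5 a6 a7 a8 a9 a10 a11 s 1 = a1 := rfl
@[simp] theorem mem_apply_2 : mem a0 a1 a2 a3 a4 a5 a6 a7 a8 a9 a10 a11 s 2 = a2 := rfl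
@[simp] theorem mem_apply_3 : mem a0 a1 a2 a3 a4 a5 a6 a7 a8 a9 a10 a11 s 3 = a3 := rfl
@[simp] theorem mem_apply_4 : mem a0 a1 a2 a3 a4 a5 a6 a7 a8 a9 a10 a11 s 4 = a4 := rfl
@[simp] theorem mem_apply_5 : mem a0 a1 a2 a3 a4 a5 a6 a7 a8 a9 a10 a11 s 5 = a5 := rfl
@[simp] theorem mem_apply_6 : mem a0 a1 a2 a3 a4 a5 a6 a7 a8 a9 a10 a11 s 6 = a6 := rfl
@[simp] theorem mem_apply_7 : mem a0 a1 a2 a3 a4 a5 a6 a7 a8 a9 a10 a11 s 7 = a7 := rfl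
@[simp] theorem mem_apply_8 : mem a0 a1 a2 a3 a4 a5 a6 a7 a8 a9 a10 a11 s 8 = a8 := rfl
@[simp] theorem mem_apply_9 : mem a0 a1 a2 a3 a4 a5 a6 a7 a8 a9 a10 a11 s 9 = a9 := rfl
@[simp] theorem mem_apply_10 : mem a0 a1 a2 a3 a4 a5 a6 a7 a8 a9 a10 a11 s 10 = a10 := rfl
@[simp] theorem mem_apply_11 : mem a0 a1 a2 a3 a4 a5 a6 a7 a8 a9 a10 a11 s 11 = a11 := rfl

theorem mem_apply_add (r : ℕ) : mem a0 a1 a2 a3 a4 a5 a6 a7 a8 a9 a10 a11 s (r + 12) = s r :=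
  join_add _ _ _

@[simp] theorem mem_apply_12 : mem a0 a1 a2 a3 a4 a5 a6 a7 a8 a9 a10 a11 s 12 = s 0 := rfl
@[simp] theorem mem_apply_13 : mem a0 a1 a2 a3 a4 a5 a6 a7 a8 a9 a10 a11 s 13 = s 1 := rfl
@[simp] theorem mem_apply_14 : mem a0 a1 a2 a3 a4 a5 a6 a7 a8 a9 a10 a11 s 14 = s 2 := rfl

theorem update_mem_add (r : ℕ) :
    Function.update (mem a0 a1 a2 a3 a4 a5 a6 a7 a8 a9 a10 a11 s) (r + 12) l =
      mem a0 a1 a2 a3 a4 a5 a6 a7 a8 a9 a10 a11 (Function.update s r l) :=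
  update_join_add _ _ _ _

@[simp] theorem update_mem_12 :
    Function.update (mem a0 a1 a2 a3 a4 a5 a6 a7 a8 a9 a10 a11 s) 12 l =
      mem a0 a1 a2 a3 a4 a5 a6 a7 a8 a9 a10 a11 (Function.update s 0 l) :=
  update_join_add _ _ 0 _

@[simp] theorem update_mem_13 :
    Function.update (mem a0 a1 a2 a3 a4 a5 a6 a7 a8 a9 a10 a11 s) 13 l =
      mem a0 a1 a2 a3 a4 a5 a6 a7 a8 a9 a10 a11 (Function.update s 1 l) :=
  update_join_add _ _ 1 _

@[simp] theorem update_mem_14 :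
    Function.update (mem a0 a1 a2 a3 a4 a5 a6 a7 a8 a9 a10 a11 s) 14 l =
      mem a0 a1 a2 a3 a4 a5 a6 a7 a8 a9 a10 a11 (Function.update s 2 l) :=
  update_join_add _ _ 2 _

theorem update_join_lt (P : Fin 12 → List Bool) (r : Fin 12) :
    Function.update (join P s) (r : ℕ) l = join (Function.update P r l) s := by
  funext i
  by_cases hi : i = r
  · subst hi; simp [join]
  · rw [Function.update_of_ne hi]
    unfold join
    split_ifs with h
    · rw [Function.update_of_ne]
      exact fun h' => hi (congrArg Fin.val h')
    · rfl

@[simp] theorem update_mem_0 :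
    Function.update (mem a0 a1 a2 a3 a4 a5 a6 a7 a8 a9 a10 a11 s) 0 l =
      mem l a1 a2 a3 a4 a5 a6 a7 a8 a9 a10 a11 s := by
  refine (update_join_lt l s _ 0).trans (congrArg (join · s) ?_)
  funext i; fin_cases i <;> rfl

@[simp] theorem update_mem_2 :
    Function.update (mem a0 a1 a2 a3 a4 a5 a6 a7 a8 a9 a10 a11 s) 2 l =
      mem a0 a1 l a3 a4 a5 a6 a7 a8 a9 a10 a11 s := by
  refine (update_join_lt l s _ 2).trans (congrArg (join · s) ?_)
  funext i; fin_cases i <;> rfl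

@[simp] theorem update_mem_3 :
    Function.update (mem a0 a1 a2 a3 a4 a5 a6 a7 a8 a9 a10 a11 s) 3 l =
      mem a0 a1 a2 l a4 a5 a6 a7 a8 a9 a10 a11 s := by
  refine (update_join_lt l s _ 3).trans (congrArg (join · s) ?_)
  funext i; fin_cases i <;> rfl

@[simp] theorem update_mem_4 :
    Function.update (mem a0 a1 a2 a3 a4 a5 a6 a7 a8 a9 a10 a11 s) 4 l =
      mem a0 a1 a2 a3 l a5 a6 a7 a8 a9 a10 a11 s := by
  refine (update_join_lt l s _ 4).trans (congrArg (join · s) ?_)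
  funext i; fin_cases i <;> rfl

@[simp] theorem update_mem_5 :
    Function.update (mem a0 a1 a2 a3 a4 a5 a6 a7 a8 a9 a10 a11 s) 5 l =
      mem a0 a1 a2 a3 a4 l a6 a7 a8 a9 a10 a11 s := by
  refine (update_join_lt l s _ 5).trans (congrArg (join · s) ?_)
  funext i; fin_cases i <;> rfl

@[simp] theorem update_mem_6 :
    Function.update (mem a0 a1 a2 a3 a4 a5 a6 a7 a8 a9 a10 a11 s) 6 l =
      mem a0 a1 a2 a3 a4 a5 l a7 a8 a9 a10 a11 s := by
  refine (update_join_lt l s _ 6).trans (congrArg (join · s) ?_)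
  funext i; fin_cases i <;> rfl

@[simp] theorem update_mem_7 :
    Function.update (mem a0 a1 a2 a3 a4 a5 a6 a7 a8 a9 a10 a11 s) 7 l =
      mem a0 a1 a2 a3 a4 a5 a6 l a8 a9 a10 a11 s := by
  refine (update_join_lt l s _ 7).trans (congrArg (join · s) ?_)
  funext i; fin_cases i <;> rfl

@[simp] theorem update_mem_8 :
    Function.update (mem a0 a1 a2 a3 a4 a5 a6 a7 a8 a9 a10 a11 s) 8 l =
      mem a0 a1 a2 a3 a4 a5 a6 a7 l a9 a10 a11 s := by
  refine (update_join_lt l s _ 8).trans (congrArg (join · s) ?_)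
  funext i; fin_cases i <;> rfl

@[simp] theorem update_mem_9 :
    Function.update (mem a0 a1 a2 a3 a4 a5 a6 a7 a8 a9 a10 a11 s) 9 l =
      mem a0 a1 a2 a3 a4 a5 a6 a7 a8 l a10 a11 s := by
  refine (update_join_lt l s _ 9).trans (congrArg (join · s) ?_)
  funext i; fin_cases i <;> rfl

@[simp] theorem update_mem_10 :
    Function.update (mem a0 a1 a2 a3 a4 a5 a6 a7 a8 a9 a10 a11 s) 10 l =
      mem a0 a1 a2 a3 a4 a5 a6 a7 a8 a9 l a11 s := by
  refine (update_join_lt l s _ 10).trans (congrArg (join · s) ?_)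
  funext i; fin_cases i <;> rfl

@[simp] theorem update_mem_11 :
    Function.update (mem a0 a1 a2 a3 a4 a5 a6 a7 a8 a9 a10 a11 s) 11 l =
      mem a0 a1 a2 a3 a4 a5 a6 a7 a8 a9 a10 l s := by
  refine (update_join_lt l s _ 11).trans (congrArg (join · s) ?_)
  funext i; fin_cases i <;> rfl

end mem

/-! ### Basic routines -/

/-- Move the content of register `a` to register `b`, reversing it. -/
def move (a b : ℕ) : Prog Unit :=
  Prog.loop a (Prog.branch a Prog.skip (Prog.seq (Prog.pop a) (Prog.push b false))
    (Prog.seq (Prog.pop a) (Prog.push b true)))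

theorem det_move {a b : ℕ} (hab : a ≠ b) (s : Store) :
    Det (move a b) s (8 * (s a).length + 1)
      (Function.update (Function.update s a []) b ((s a).reverse ++ s b)) := by
  generalize hl : s a = l
  induction l generalizing s with
  | nil =>
    have : Function.update (Function.update s a []) b ([].reverse ++ s b) = s := by
      rw [← hl, Function.update_eq_self, hl]
      simp
    rw [this]
    exact Det.loop_nil hl
  | cons x l ih =>
    have h₁ := Det.straight (c := Prog.branch a Prog.skip
      (Prog.seq (Prog.pop a) (Prog.push b false)) (Prog.seq (Prog.pop a) (Prog.push b true)))
      (by simp [Straight]) s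
    have h₂ := ih (Function.update (Function.update s a l) b (x :: s b)) (by simp [hab])
    have h₃ : ev (Prog.branch a Prog.skip
      (Prog.seq (Prog.pop a) (Prog.push b false)) (Prog.seq (Prog.pop a) (Prog.push b true))) s =
        Function.update (Function.update s a l) b (x :: s b) := by
      cases x <;> simp [ev, hl, select, hab.symm]
    rw [h₃] at h₁
    have h₄ := Det.loop_cons (by simp [hl]) h₁ h₂
    have h₅ : Function.update (Function.update (Function.update (Function.update s a l) b
        (x :: s b)) a []) b (l.reverse ++ Function.update (Function.update s a l) b (x :: s b) b) =
        Function.update (Function.update s a []) b ((x :: l).reverse ++ s b) := by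
      rw [Function.update_comm hab.symm]
      simp
    rw [h₅] at h₄
    refine h₄.mono ?_
    simp [psize]
    omega

/-- Empty register `a`. -/
def clear (a : ℕ) : Prog Unit := Prog.loop a (Prog.pop a)

theorem det_clear (a : ℕ) (s : Store) :
    Det (clear a) s (2 * (s a).length + 1) (Function.update s a []) := by
  generalize hl : s a = l
  induction l generalizing s with
  | nil =>
    rw [← hl, Function.update_eq_self]
    exact (Det.loop_nil hl).mono (by omega)
  | cons x l ih =>
    have h₁ := Det.straight (c := Prog.pop a) (by simp [Straight]) s
    have h₂ := ih (ev (Prog.pop a) s) (by simp [ev, hl])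
    have h₃ := Det.loop_cons (by simp [hl]) h₁ h₂
    simp only [ev, Function.update_idem] at h₃
    refine h₃.mono ?_
    simp [psize]
    omega

/-- Move the content of register `z` to both registers `a` and `b`, reversing it. -/
def fork (z a b : ℕ) : Prog Unit :=
  Prog.loop z (Prog.branch z Prog.skip
    (Prog.seq (Prog.pop z) (Prog.seq (Prog.push a false) (Prog.push b false)))
    (Prog.seq (Prog.pop z) (Prog.seq (Prog.push a true) (Prog.push b true))))

theorem det_fork {z a b : ℕ} (hza : z ≠ a) (hzb : z ≠ b) (hab : a ≠ b) (s : Store) :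
    Det (fork z a b) s (12 * (s z).length + 1)
      (Function.update (Function.update (Function.update s z []) a ((s z).reverse ++ s a))
        b ((s z).reverse ++ s b)) := by
  generalize hl : s z = l
  induction l generalizing s with
  | nil =>
    have : Function.update (Function.update (Function.update s z []) a ([].reverse ++ s a))
        b ([].reverse ++ s b) = s := by
      rw [← hl, Function.update_eq_self, hl]
      simp
    rw [this]
    exact Det.loop_nil hl
  | cons x l ih =>
    have h₁ := Det.straight (c := Prog.branch z Prog.skip
      (Prog.seq (Prog.pop z) (Prog.seq (Prog.push a false) (Prog.push b false)))
      (Prog.seq (Prog.pop z) (Prog.seq (Prog.push a true) (Prog.push b true))))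
      (by simp [Straight]) s
    have h₂ := ih (Function.update (Function.update (Function.update s z l) a (x :: s a))
      b (x :: s b)) (by simp [hza, hzb])
    have h₃ : ev (Prog.branch z Prog.skip
      (Prog.seq (Prog.pop z) (Prog.seq (Prog.push a false) (Prog.push b false)))
      (Prog.seq (Prog.pop z) (Prog.seq (Prog.push a true) (Prog.push b true)))) s =
        Function.update (Function.update (Function.update s z l) a (x :: s a)) b (x :: s b) := by
      cases x <;> simp [ev, hl, select, hza.symm, hzb.symm, hab.symm]
    rw [h₃] at h₁
    have h₄ := Det.loop_cons (by simp [hl]) h₁ h₂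
    refine Eq.subst (motive := fun s' => Det _ _ _ s') ?_ (h₄.mono ?_)
    · rw [Function.update_comm hzb.symm, Function.update_comm hza.symm]
      simp [hab]
      rw [Function.update_comm hab.symm]
      simp
    · simp [psize]
      omega

/-- Copy the content of register `a` to register `b`, using the register `z`. -/
def copy (a b z : ℕ) : Prog Unit := Prog.seq (move a z) (fork z a b)

theorem det_copy {z a b : ℕ} (hza : z ≠ a) (hzb : z ≠ b) (hab : a ≠ b) (s : Store)
    (hz : s z = []) :
    Det (copy a b z) s (20 * (s a).length + 3) (Function.update s b (s a ++ s b)) := by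
  have h := (det_move hza.symm s).seq (det_fork hza hzb hab _)
  refine Eq.subst (motive := fun s' => Det _ _ _ s') ?_ (h.mono ?_)
  · funext i
    by_cases h1 : i = z <;> by_cases h2 : i = a <;> by_cases h3 : i = b <;> simp_all
  · simp [hz]
    omega

/-- Push a list of bits; the first one will be on top. -/
def pushList (r : ℕ) : List Bool → Prog Unit
  | [] => Prog.skip
  | b :: l => Prog.seq (pushList r l) (Prog.push r b)

theorem det_pushList (r : ℕ) (l : List Bool) (s : Store) :
    Det (pushList r l) s (2 * l.length + 1) (Function.update s r (l ++ s r)) := by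
  induction l with
  | nil => simpa [pushList, psize, ev] using Det.straight (c := Prog.skip) (by simp [Straight]) s
  | cons b l ih =>
    have h := ih.seq (Det.straight (c := Prog.push r b) (by simp [Straight]) _)
    simp only [ev, Function.update_idem, Function.update_self] at h
    exact h.mono (by simp [psize]; omega)

/-- Empty the registers `12, …, 12 + W - 1`. -/
def clearAll : ℕ → Prog Unit
  | 0 => Prog.skip
  | W + 1 => Prog.seq (clearAll W) (clear (W + 12))

theorem det_clearAll (W B : ℕ) (P : Fin 12 → List Bool) (s : Store)
    (hB : ∀ r < W, (s r).length ≤ B) :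
    Det (clearAll W) (join P s) (W * (2 * B + 3) + 1)
      (join P fun r => if r < W then [] else s r) := by
  induction W with
  | zero => simpa [clearAll, psize, ev] using
      Det.straight (c := Prog.skip) (by simp [Straight]) (join P s)
  | succ W ih =>
    have h := (ih fun r hr => hB r (by omega)).seq (det_clear (W + 12) _)
    refine Eq.subst (motive := fun s' => Det _ _ _ s') ?_ (h.mono ?_)
    · rw [update_join_add]
      congr 1
      funext r
      by_cases hr : r = W
      · subst hr; simp
      · rw [Function.update_of_ne hr]
        by_cases h : r < W
        · rw [if_pos h, if_pos (by omega)]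
        · rw [if_neg h, if_neg (by omega)]
    · have := hB W (by omega)
      rw [join_add, if_neg (by omega)]
      ring_nf
      omega

/-! ### Resource bounds -/

/-- All registers of the program are below this bound. -/
def regBound {Q : Type} : Prog Q → ℕ
  | Prog.skip => 0
  | Prog.push r _ => r + 1
  | Prog.pop r => r + 1
  | Prog.ask r _ => r + 1
  | Prog.seq c d => max (regBound c) (regBound d)
  | Prog.branch r c d e => max (r + 1) (max (regBound c) (max (regBound d) (regBound e)))
  | Prog.loop r c => max (r + 1) (regBound c)

theorem step_support {Q : Type} {o : Oracle Q} {W G : ℕ} (hG : ∀ q, ∀ a ∈ (o q).support,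
    a.length ≤ G) (hG1 : 1 ≤ G) {c c' : Config Q} (hc : ∀ p ∈ c.1, regBound p ≤ W)
    (hc' : c' ∈ (step o c).support) :
    (∀ p ∈ c'.1, regBound p ≤ W) ∧ ∀ r, (W ≤ r → c'.2 r = c.2 r) ∧
      (c'.2 r).length ≤ (c.2 r).length + G := by
  obtain ⟨k, s⟩ := c
  have key : ∀ (r₀ : ℕ) (l : List Bool), r₀ + 1 ≤ W → l.length ≤ (s r₀).length + G →
      ∀ r, (W ≤ r → Function.update s r₀ l r = s r) ∧
        (Function.update s r₀ l r).length ≤ (s r).length + G := by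
    intro r₀ l hr₀ hl r
    by_cases h : r = r₀
    · subst h
      exact ⟨fun h => absurd h (by omega), by simpa using hl⟩
    · rw [Function.update_of_ne h]
      exact ⟨fun _ => rfl, by omega⟩
  have key' : ∀ r, (W ≤ r → s r = s r) ∧ (s r).length ≤ (s r).length + G :=
    fun r => ⟨fun _ => rfl, by omega⟩
  rcases k with _ | ⟨c, k⟩
  · rw [step, PMF.mem_support_pure_iff] at hc'
    subst hc'
    exact ⟨hc, key'⟩
  rw [List.forall_mem_cons] at hc
  obtain ⟨h1, h2⟩ := hc
  rcases c with _ | ⟨r, b⟩ | r | ⟨r, q⟩ | ⟨c, d⟩ | ⟨r, c, d, e⟩ | ⟨r, c⟩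
  · rw [step, PMF.mem_support_pure_iff] at hc'
    subst hc'
    exact ⟨h2, key'⟩
  · rw [step, PMF.mem_support_pure_iff] at hc'
    subst hc'
    exact ⟨h2, key _ _ h1 (by simpa using hG1)⟩
  · rw [step, PMF.mem_support_pure_iff] at hc'
    subst hc'
    exact ⟨h2, key _ _ h1 (by simp; omega)⟩
  · rw [step, PMF.mem_support_map_iff] at hc'
    obtain ⟨a, ha, rfl⟩ := hc'
    have := hG q a ha
    exact ⟨h2, key _ _ h1 (by simp; omega)⟩
  · rw [step, PMF.mem_support_pure_iff] at hc'
    subst hc'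
    simp only [regBound, max_le_iff] at h1
    exact ⟨by simpa using ⟨h1.1, h1.2, h2⟩, key'⟩
  · simp only [regBound, max_le_iff] at h1
    obtain ⟨-, hc, hd, he⟩ := h1
    rcases hr : s r with _ | ⟨_ | _, l⟩ <;>
    · simp only [step, hr] at hc'
      rw [PMF.mem_support_pure_iff] at hc'
      subst hc'
      refine ⟨?_, key'⟩
      rw [List.forall_mem_cons]
      exact ⟨by assumption, h2⟩
  · rcases hr : s r with _ | ⟨b, l⟩
    · simp only [step, hr] at hc'
      rw [PMF.mem_support_pure_iff] at hc'
      subst hc'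
      exact ⟨h2, key'⟩
    · simp only [step, hr] at hc'
      rw [PMF.mem_support_pure_iff] at hc'
      subst hc'
      refine ⟨?_, key'⟩
      rw [List.forall_mem_cons, List.forall_mem_cons]
      refine ⟨?_, h1, h2⟩
      simp only [regBound, max_le_iff] at h1
      exact h1.2

/-- Per step a register grows by at most one oracle answer, and only registers named in the program
change. This bounds the length of the learner's output and tells which registers must be emptied
after a simulation. -/
theorem runFor_support {Q : Type} {o : Oracle Q} {W G : ℕ} (hG : ∀ q, ∀ a ∈ (o q).support,
    a.length ≤ G) (hG1 : 1 ≤ G) (t : ℕ) {c c' : Config Q} (hc : ∀ p ∈ c.1, regBound p ≤ W)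
    (hc' : c' ∈ (runFor o t c).support) (r : ℕ) :
    (W ≤ r → c'.2 r = c.2 r) ∧ (c'.2 r).length ≤ (c.2 r).length + t * G := by
  induction t generalizing c with
  | zero =>
    rw [runFor, PMF.mem_support_pure_iff] at hc'
    subst hc'
    exact ⟨fun _ => rfl, by omega⟩
  | succ t ih =>
    rw [runFor, PMF.mem_support_bind_iff] at hc'
    obtain ⟨c'', h1, h2⟩ := hc'
    obtain ⟨h3, h4⟩ := step_support hG hG1 hc h1
    obtain ⟨h5, h6⟩ := ih h3 h2
    refine ⟨fun hr => (h5 hr).trans ((h4 r).1 hr), ?_⟩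
    have := (h4 r).2
    rw [add_mul]
    omega

/-! ### Parsing constraints

Register `0` holds `n` bits `false`, register `2` a list of constraints. The next constraint is
turned into an example, with instance in register `3` and label in register `4`. The registers `5`
and `6` are used for intermediate results. -/

def parseSign : Prog Unit :=
  Prog.branch 2 Prog.skip (Prog.pop 2) (Prog.seq (Prog.pop 2)
    (Prog.branch 4 Prog.skip (Prog.seq (Prog.pop 4) (Prog.push 4 true))
      (Prog.seq (Prog.pop 4) (Prog.push 4 false))))

/-- Register `6` is a flag that keeps the loop alive. A `1` of the unary index walks one position
along the vector by moving a bit from `3` to `5`; the delimiter `0` sets the current bit and drops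
the flag. On exhausted input the flag is dropped as well, so that the loop always ends. -/
def parseIndexStep : Prog Unit :=
  Prog.branch 2 (Prog.pop 6)
    (Prog.seq (Prog.pop 2) (Prog.seq (Prog.seq (Prog.pop 3) (Prog.push 3 true)) (Prog.pop 6)))
    (Prog.seq (Prog.pop 2) (Prog.branch 3 Prog.skip (Prog.seq (Prog.pop 3) (Prog.push 5 false))
      (Prog.seq (Prog.pop 3) (Prog.push 5 true))))

def parseField : Prog Unit :=
  Prog.seq parseSign (Prog.seq (Prog.push 6 true)
    (Prog.seq (Prog.loop 6 parseIndexStep) (move 5 3)))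

def parseFields : ℕ → Prog Unit
  | 0 => Prog.skip
  | K + 1 => Prog.seq parseField (parseFields K)

/-- The label starts at `true` and absorbs the signs, because `P = 1` means that the variables sum
to `1` plus the signs. On an empty list it starts at `false`, which produces the padding example. -/
def parse (K : ℕ) : Prog Unit :=
  Prog.seq (clear 3) (Prog.seq (clear 4) (Prog.seq (copy 0 3 5)
    (Prog.seq (Prog.branch 2 (Prog.push 4 false) (Prog.push 4 true) (Prog.push 4 true))
      (parseFields K))))

/-- The encoding of one place of a constraint. -/
def encodeField (f : Bool × ℕ) : List Bool := f.1 :: (unary f.2 ++ [false])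

section

variable (a0 a1 a7 a8 a9 a10 a11 : List Bool) (s : Store)

/-- `A` is the part of the vector before the position to be set, and `Z` collects in reverse what
has been passed. A later `move` restores the order. -/
theorem det_parseIndex (A B rest Y Z : List Bool) (x : Bool) :
    Det (Prog.loop 6 parseIndexStep)
      (mem a0 a1 (unary A.length ++ false :: rest) (A ++ x :: B) Y Z [true] a7 a8 a9 a10 a11 s)
      (12 * A.length + 12)
      (mem a0 a1 rest (true :: B) Y (A.reverse ++ Z) [] a7 a8 a9 a10 a11 s) := by
  have hst : Straight parseIndexStep := by simp [parseIndexStep, Straight]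
  induction A generalizing Z with
  | nil =>
    have h := Det.loop_cons (r := 6) (by simp) (Det.straight hst
      (mem a0 a1 (unary 0 ++ false :: rest) (x :: B) Y Z [true] a7 a8 a9 a10 a11 s))
      (Det.loop_nil (by simp [parseIndexStep, ev, unary, select]))
    simp only [parseIndexStep, ev, unary, select, List.replicate_zero, List.nil_append,
      mem_apply_2, update_mem_2, List.tail_cons, mem_apply_3, update_mem_3, mem_apply_6,
      update_mem_6] at h
    exact h.mono (by simp [psize])
  | cons y A ih =>
    have h := Det.loop_cons (r := 6) (s'' := mem a0 a1 rest (true :: B) Y (A.reverse ++ y :: Z) []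
      a7 a8 a9 a10 a11 s) (t₂ := 12 * A.length + 12) (by simp) (Det.straight hst
      (mem a0 a1 (unary (A.length + 1) ++ false :: rest) (y :: (A ++ x :: B)) Y Z [true]
        a7 a8 a9 a10 a11 s)) (by
      have h' := ih (y :: Z)
      cases y <;> simpa [parseIndexStep, ev, unary, select, List.replicate_succ] using h')
    simp only [List.reverse_cons, List.append_assoc, List.singleton_append]
    exact h.mono (by simp [psize, parseIndexStep]; omega)

theorem det_parseField {n : ℕ} (f : Bool × ℕ) (X rest : List Bool) (y : Bool) (hX : X.length = n)
    (hf : f.2 < n) :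
    Det parseField
      (mem a0 a1 (encodeField f ++ rest) X [y] [] [] a7 a8 a9 a10 a11 s)
      (20 * n + 40)
      (mem a0 a1 rest (X.set f.2 true) [xor y f.1] [] [] a7 a8 a9 a10 a11 s) := by
  obtain ⟨b, i⟩ := f
  simp only at hf
  obtain ⟨A, x, B, rfl, rfl⟩ : ∃ A x B, X = A ++ x :: B ∧ A.length = i := by
    refine ⟨X.take i, X[i]'(by omega), X.drop (i + 1), ?_, by simp; omega⟩
    simp
  have h₁ := Det.straight (c := parseSign) (by simp [parseSign, Straight])
    (mem a0 a1 (encodeField (b, A.length) ++ rest) (A ++ x :: B) [y] [] [] a7 a8 a9 a10 a11 s)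
  have h₂ : ev parseSign (mem a0 a1 (encodeField (b, A.length) ++ rest) (A ++ x :: B) [y] [] []
      a7 a8 a9 a10 a11 s) = mem a0 a1 (unary A.length ++ false :: rest) (A ++ x :: B) [xor y b]
        [] [] a7 a8 a9 a10 a11 s := by
    cases b <;> cases y <;> simp [parseSign, ev, encodeField, select]
  rw [h₂] at h₁
  have h₃ := Det.straight (c := Prog.push 6 true) (by simp [Straight])
    (mem a0 a1 (unary A.length ++ false :: rest) (A ++ x :: B) [xor y b]
        [] [] a7 a8 a9 a10 a11 s)
  simp only [ev, mem_apply_6, update_mem_6] at h₃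
  have h₄ := det_parseIndex a0 a1 a7 a8 a9 a10 a11 s A B rest [xor y b] [] x
  have h₅ := det_move (a := 5) (b := 3) (by simp) (mem a0 a1 rest (true :: B) [xor y b]
    (A.reverse ++ []) [] a7 a8 a9 a10 a11 s)
  simp only [List.append_nil, mem_apply_5, mem_apply_3, update_mem_5, update_mem_3,
    List.reverse_reverse] at h₄ h₅
  have h := h₁.seq (h₃.seq (h₄.seq h₅))
  simp only [List.set_append_right _ _ le_rfl, Nat.sub_self, List.set_cons_zero]
  refine h.mono ?_
  simp [psize, parseSign] at hX ⊢
  omega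

/-- A random index may run past the end of the instance, so parsing nothing has to be harmless. -/
theorem det_parseField_nil (X Y : List Bool) :
    Det parseField (mem a0 a1 [] X Y [] [] a7 a8 a9 a10 a11 s) 40
      (mem a0 a1 [] X Y [] [] a7 a8 a9 a10 a11 s) := by
  have h₁ := Det.straight (c := parseSign) (by simp [parseSign, Straight])
    (mem a0 a1 [] X Y [] [] a7 a8 a9 a10 a11 s)
  have h₃ := Det.straight (c := Prog.push 6 true) (by simp [Straight])
    (mem a0 a1 [] X Y [] [] a7 a8 a9 a10 a11 s)
  have h₄ := Det.loop_cons (r := 6) (c := parseIndexStep) (by simp)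
    (Det.straight (by simp [parseIndexStep, Straight])
    (mem a0 a1 [] X Y [] [true] a7 a8 a9 a10 a11 s))
      (Det.loop_nil (by simp [parseIndexStep, ev, select]))
  have h₅ := det_move (a := 5) (b := 3) (by simp) (mem a0 a1 [] X Y [] [] a7 a8 a9 a10 a11 s)
  simp only [ev, parseSign, parseIndexStep, select, mem_apply_2, mem_apply_6, update_mem_6,
    List.tail_cons, mem_apply_5, update_mem_5, update_mem_3, mem_apply_3, List.reverse_nil,
    List.nil_append] at h₁ h₃ h₄ h₅
  exact (h₁.seq (h₃.seq (h₄.seq h₅))).mono (by simp [psize])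

theorem det_parseFields {n : ℕ} (l : List (Bool × ℕ)) (X rest : List Bool) (y : Bool)
    (hX : X.length = n) (hl : ∀ f ∈ l, f.2 < n) :
    Det (parseFields l.length)
      (mem a0 a1 ((l.map encodeField).flatten ++ rest) X [y] [] [] a7 a8 a9 a10 a11 s)
      (l.length * (20 * n + 41) + 1)
      (mem a0 a1 rest (l.foldl (fun X f => X.set f.2 true) X)
        [l.foldl (fun y f => xor y f.1) y] [] [] a7 a8 a9 a10 a11 s) := by
  induction l generalizing X y with
  | nil =>
    simpa [parseFields, psize, ev] using Det.straight (c := Prog.skip) (by simp [Straight])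
      (mem a0 a1 rest X [y] [] [] a7 a8 a9 a10 a11 s)
  | cons f l ih =>
    rw [List.forall_mem_cons] at hl
    have h₁ := det_parseField a0 a1 a7 a8 a9 a10 a11 s f X ((l.map encodeField).flatten ++ rest) y
      hX hl.1
    have h₂ := ih (X.set f.2 true) (xor y f.1) (by simpa using hX) hl.2
    rw [List.map_cons, List.flatten_cons, List.append_assoc]
    refine (h₁.seq h₂).mono ?_
    rw [List.length_cons, add_mul]
    omega

theorem det_parseFields_nil (K : ℕ) (X Y : List Bool) :
    Det (parseFields K) (mem a0 a1 [] X Y [] [] a7 a8 a9 a10 a11 s) (K * 41 + 1)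
      (mem a0 a1 [] X Y [] [] a7 a8 a9 a10 a11 s) := by
  induction K with
  | zero => exact Det.straight (c := Prog.skip) (by simp [Straight]) _
  | succ K ih =>
    refine ((det_parseField_nil a0 a1 a7 a8 a9 a10 a11 s X Y).seq ih).mono ?_
    rw [add_mul]
    omega

/-- The list of the places of a constraint. -/
def Constraint.fields {K n : ℕ} (C : Constraint K n) : List (Bool × ℕ) :=
  List.ofFn fun l => (C.1 l, (C.2 l : ℕ))

/-- The encoding of a list of constraints. -/
def encodeList {K n : ℕ} (Cs : List (Constraint K n)) : List Bool :=
  (Cs.map fun C => (C.fields.map encodeField).flatten).flatten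

theorem encodeInstance_eq {K n m : ℕ} (J : Instance K n m) :
    encodeInstance J = encodeList (List.ofFn J) := by
  simp only [encodeInstance, encodeList, Constraint.fields, List.map_ofFn]
  rfl

/-- The example that belongs to a constraint: an assignment satisfies the constraint if and only if
the corresponding parity function is correct on the example. -/
def Constraint.toExample {K n : ℕ} (C : Constraint K n) : (Fin n → Bool) × Bool :=
  (fun v => decide (∃ l, C.2 l = v), (List.ofFn C.1).foldl xor true)

/-- The example that belongs to the first constraint of a list. -/
def headExample {K n : ℕ} (Cs : List (Constraint K n)) : (Fin n → Bool) × Bool :=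
  match Cs with
  -- The padding example: every parity vanishes at the zero vector and is correct here.
  | [] => (fun _ => false, false)
  | C :: _ => C.toExample

theorem foldl_set (n : ℕ) (l : List (Bool × ℕ)) (X : Fin n → Bool) (hl : ∀ f ∈ l, f.2 < n) :
    l.foldl (fun X f => X.set f.2 true) (List.ofFn X) =
      List.ofFn fun v => X v || decide (∃ f ∈ l, f.2 = (v : ℕ)) := by
  induction l generalizing X with
  | nil => simp
  | cons f l ih =>
    rw [List.forall_mem_cons] at hl
    have : (List.ofFn X).set f.2 true = List.ofFn (Function.update X ⟨f.2, hl.1⟩ true) := by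
      refine List.ext_getElem (by simp) fun i h1 h2 => ?_
      rw [List.getElem_set]
      split_ifs with h
      · subst h; simp
      · rw [List.getElem_ofFn, List.getElem_ofFn, Function.update_of_ne]
        simpa [Fin.ext_iff] using fun h' => h h'.symm
    rw [List.foldl_cons, this, ih _ hl.2]
    congr 1
    funext v
    by_cases h : f.2 = v
    · have hv : v = ⟨f.2, hl.1⟩ := Fin.ext h.symm
      subst hv; simp
    · rw [Function.update_of_ne (fun h' => h (by rw [h']))]
      simp [h]

theorem det_parse {K n : ℕ} (hK : 0 < K) (Cs : List (Constraint K n)) (X Y : List Bool)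
    (hX : X.length ≤ n) (hY : Y.length ≤ 1) :
    Det (parse K)
      (mem (List.replicate n false) a1 (encodeList Cs) X Y [] [] a7 a8 a9 a10 a11 s)
      (30 * n + 20 + K * (20 * n + 41))
      (mem (List.replicate n false) a1 (encodeList Cs.tail) (List.ofFn (headExample Cs).1)
        [(headExample Cs).2] [] [] a7 a8 a9 a10 a11 s) := by
  set N := List.replicate n false with hN
  have h₁ := det_clear 3 (mem N a1 (encodeList Cs) X Y [] [] a7 a8 a9 a10 a11 s)
  have h₂ := det_clear 4 (mem N a1 (encodeList Cs) [] Y [] [] a7 a8 a9 a10 a11 s)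
  have h₃ := det_copy (a := 0) (b := 3) (z := 5) (by simp) (by simp) (by simp)
    (mem N a1 (encodeList Cs) [] [] [] [] a7 a8 a9 a10 a11 s) (by simp)
  have h₄ := Det.straight
    (c := Prog.branch 2 (Prog.push 4 false) (Prog.push 4 true) (Prog.push 4 true))
    (by simp [Straight]) (mem N a1 (encodeList Cs) N [] [] [] a7 a8 a9 a10 a11 s)
  simp only [mem_apply_3, mem_apply_4, mem_apply_0, update_mem_3, update_mem_4,
    List.append_nil] at h₁ h₂ h₃
  have hNl : N.length = n := by simp [hN]
  rcases Cs with _ | ⟨C, Cs⟩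
  · have h₅ := det_parseFields_nil N a1 a7 a8 a9 a10 a11 s K N [false]
    have h := h₁.seq (h₂.seq (h₃.seq (h₄.seq (t₂ := K * 41 + 1) (s'' := mem N a1 [] N [false] [] []
      a7 a8 a9 a10 a11 s) (d := parseFields K) (by
        simpa [ev, select, encodeList] using h₅))))
    have h₆ : List.ofFn (headExample ([] : List (Constraint K n))).1 = N := by
      simp [headExample, hN]
    rw [h₆]
    refine h.mono ?_
    simp only [psize, hNl]
    have : K * 41 ≤ K * (20 * n + 41) := Nat.mul_le_mul_left _ (by omega)
    simp
    omega
  · have hl : ∀ f ∈ C.fields, f.2 < n := by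
      intro f hf
      simp only [Constraint.fields, List.mem_ofFn] at hf
      obtain ⟨l, rfl⟩ := hf
      exact (C.2 l).2
    have hK' : C.fields.length = K := by simp [Constraint.fields]
    have henc : encodeList (C :: Cs) = (C.fields.map encodeField).flatten ++ encodeList Cs := by
      simp [encodeList]
    have h₅ := det_parseFields N a1 a7 a8 a9 a10 a11 s C.fields N (encodeList Cs) true hNl hl
    -- Positive arity makes the encoding of a nonempty list nonempty, so the branch on register `2`
    -- recognises the end of the instance.
    have hne : ∃ b l, encodeList (C :: Cs) = b :: l := by
      obtain ⟨K, rfl⟩ : ∃ K', K = K' + 1 := ⟨K - 1, by omega⟩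
      rw [henc, Constraint.fields, List.ofFn_succ]
      exact ⟨_, _, rfl⟩
    have h₆ : ev (Prog.branch 2 (Prog.push 4 false) (Prog.push 4 true) (Prog.push 4 true))
        (mem N a1 (encodeList (C :: Cs)) N [] [] [] a7 a8 a9 a10 a11 s) =
        mem N a1 (encodeList (C :: Cs)) N [true] [] [] a7 a8 a9 a10 a11 s := by
      obtain ⟨b, l, hbl⟩ := hne
      cases b <;> simp [ev, select, hbl]
    rw [h₆, henc] at h₄
    rw [hK'] at h₅
    rw [henc] at h₁ h₂ h₃ ⊢
    have h := h₁.seq (h₂.seq (h₃.seq (h₄.seq h₅)))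
    have h₇ : C.fields.foldl (fun X f => X.set f.2 true) N =
        List.ofFn (headExample (C :: Cs)).1 := by
      have := foldl_set n C.fields (fun _ => false) hl
      rw [show List.ofFn (fun _ : Fin n => false) = N by simp [hN]] at this
      rw [this]
      simp [headExample, Constraint.toExample, Constraint.fields, List.mem_ofFn, Fin.ext_iff]
    have h₈ : C.fields.foldl (fun y f => xor y f.1) true = (headExample (C :: Cs)).2 := by
      simp only [headExample, Constraint.toExample, Constraint.fields]
      have : List.ofFn C.1 = (List.ofFn fun l => (C.1 l, (C.2 l : ℕ))).map Prod.fst := by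
        rw [List.map_ofFn]; rfl
      rw [this, List.foldl_map]
    rw [h₇, h₈] at h
    refine h.mono ?_
    simp only [psize, hNl]
    simp
    omega

end

/-! ### Drawing a random constraint -/

/-- The number with the binary expansion of `v` followed by `q` random bits. -/
def randomBits : ℕ → ℕ → PMF ℕ
  | 0, v => PMF.pure v
  | q + 1, v => (PMF.uniformOfFintype Bool).bind fun b => randomBits q (2 * v + b.toNat)

def double : Prog Unit :=
  Prog.seq (Prog.loop 7 (Prog.seq (Prog.pop 7) (Prog.seq (Prog.push 5 true) (Prog.push 5 true))))
    (move 5 7)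

def appendCoin : Prog Unit :=
  Prog.seq (Prog.ask 6 ())
    (Prog.branch 6 Prog.skip (Prog.pop 6) (Prog.seq (Prog.pop 6) (Prog.push 7 true)))

/-- The index is kept in unary, `v ↦ 2v + coin` for each mark in register `10`. Its size below `2^q`
stays polynomial because `q` will be `d * n.size`. -/
def drawIndex : Prog Unit :=
  Prog.loop 10 (Prog.seq (Prog.seq (Prog.pop 10) double) appendCoin)

/-- Draw an example and push it on register `r + 12`. -/
def drawExample (K r : ℕ) : Prog Unit :=
  Prog.seq (copy 8 10 5) (Prog.seq drawIndex (Prog.seq (copy 1 2 5) (Prog.seq (parse K)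
    (Prog.seq (Prog.loop 7 (Prog.seq (Prog.pop 7) (parse K)))
      (Prog.seq (clear 2) (Prog.seq (move 3 5) (Prog.seq (move 5 (r + 12)) (move 4 (r + 12)))))))))

theorem unary_succ (n : ℕ) : unary (n + 1) = true :: unary n := rfl

@[simp] theorem length_unary (n : ℕ) : (unary n).length = n := by simp [unary]

theorem reverse_unary (n : ℕ) : (unary n).reverse = unary n := by simp [unary]

theorem unary_append (m n : ℕ) : unary m ++ unary n = unary (m + n) := by simp [unary]

theorem unary_ne_nil {n : ℕ} (hn : n ≠ 0) : unary n ≠ [] := by simp [unary, hn]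

section

variable (a0 a1 a2 a3 a4 a7 a8 a9 a10 a11 : List Bool) (s : Store)

theorem det_double (v : ℕ) :
    Det double (mem a0 a1 a2 a3 a4 [] [] (unary v) a8 a9 a10 a11 s) (25 * v + 3)
      (mem a0 a1 a2 a3 a4 [] [] (unary (2 * v)) a8 a9 a10 a11 s) := by
  have h₁ := Det.loop (c := Prog.seq (Prog.pop 7) (Prog.seq (Prog.push 5 true) (Prog.push 5 true)))
    (r := 7) (fun i => mem a0 a1 a2 a3 a4 (unary (2 * i)) [] (unary (v - i)) a8 a9 a10 a11 s) v
    (fun i hi => unary_ne_nil (by omega)) (by simp [unary]) (fun i hi => by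
      obtain ⟨j, hj⟩ : ∃ j, v - i = j + 1 := ⟨v - i - 1, by omega⟩
      have h := Det.straight
        (c := Prog.seq (Prog.pop 7) (Prog.seq (Prog.push 5 true) (Prog.push 5 true)))
        (by simp [Straight])
        (mem a0 a1 a2 a3 a4 (unary (2 * i)) [] (unary (v - i)) a8 a9 a10 a11 s)
      simpa [ev, hj, unary_succ, mul_add, show v - (i + 1) = j by omega] using h)
  have h₂ := det_move (a := 5) (b := 7) (by simp)
    (mem a0 a1 a2 a3 a4 (unary (2 * v)) [] [] a8 a9 a10 a11 s)
  simp only [mem_apply_5, mem_apply_7, update_mem_5, update_mem_7, reverse_unary,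
    List.append_nil] at h₂
  refine (Det.seq (by simpa [unary] using h₁) h₂).mono ?_
  simp [psize]
  omega

theorem runs_appendCoin (v : ℕ) :
    Runs [appendCoin] (mem a0 a1 a2 a3 a4 [] [] (unary v) a8 a9 a10 a11 s) 6
      ((PMF.uniformOfFintype Bool).map fun b =>
        mem a0 a1 a2 a3 a4 [] [] (unary (v + b.toNat)) a8 a9 a10 a11 s) := by
  have h₁ := Runs.ask (s := mem a0 a1 a2 a3 a4 [] [] (unary v) a8 a9 a10 a11 s) 6
  rw [fairCoin, PMF.map_comp] at h₁
  refine Runs.mono (Runs.det_map h₁ fun b _ => ?_) (t := 1 + 4 + 1) le_rfl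
  have h₂ := Det.straight
    (c := Prog.branch 6 Prog.skip (Prog.pop 6) (Prog.seq (Prog.pop 6) (Prog.push 7 true)))
    (by simp [Straight]) (mem a0 a1 a2 a3 a4 [] [b] (unary v) a8 a9 a10 a11 s)
  change Det _ _ _ _
  cases b <;> simpa [ev, select, psize, unary_succ, Function.comp] using h₂

/-- `V` dominates all intermediate values: with `b ≤ 1` one has `(2v + b + 1) * 2^q ≤ (v + 1) *
2^(q+1)`, so the hypothesis is inherited. -/
theorem runs_drawIndex (V q v : ℕ) (hV : (v + 1) * 2 ^ q ≤ V) :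
    Runs [drawIndex] (mem a0 a1 a2 a3 a4 [] [] (unary v) a8 a9 (unary q) a11 s)
      (q * (25 * V + 20) + 1)
      ((randomBits q v).map fun v => mem a0 a1 a2 a3 a4 [] [] (unary v) a8 a9 [] a11 s) := by
  induction q generalizing v with
  | zero =>
    rw [randomBits, PMF.pure_map]
    exact (Det.loop_nil (by simp [unary])).mono (by omega)
  | succ q ih =>
    have hv : v ≤ V := by nlinarith [Nat.one_le_two_pow (n := q + 1)]
    have h₁ := Det.straight (c := Prog.pop 10) (by simp [Straight])
      (mem a0 a1 a2 a3 a4 [] [] (unary v) a8 a9 (unary (q + 1)) a11 s)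
    simp only [ev, mem_apply_10, unary_succ, List.tail_cons, update_mem_10] at h₁
    have h₂ := Runs.seq_det (h₁.seq (det_double a0 a1 a2 a3 a4 a8 a9 (unary q) a11 s v))
      (runs_appendCoin a0 a1 a2 a3 a4 a8 a9 (unary q) a11 s (2 * v))
    rw [randomBits, PMF.map_bind]
    refine (Runs.loop_cons (by simp [unary]) (Runs.cons_map h₂ fun b _ => ih _ ?_)).mono ?_
    · refine le_trans ?_ hV
      rw [pow_succ', ← mul_assoc]
      refine Nat.mul_le_mul_right _ ?_
      cases b <;> simp <;> omega
    · simp only [psize]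
      rw [add_mul]
      omega

end

theorem length_encodeList_le {K n : ℕ} (Cs : List (Constraint K n)) :
    (encodeList Cs).length ≤ Cs.length * (K * (n + 2)) := by
  have h : ∀ C : Constraint K n, ((C.fields.map encodeField).flatten).length ≤ K * (n + 2) := by
    intro C
    rw [List.length_flatten]
    have : (List.map List.length (List.map encodeField C.fields)).length = K := by
      simp [Constraint.fields]
    refine (List.sum_le_card_nsmul _ (n + 2) fun x hx => ?_).trans (by rw [this, smul_eq_mul])
    simp only [List.mem_map, Constraint.fields, List.mem_ofFn] at hx
    obtain ⟨_, ⟨_, ⟨l, rfl⟩, rfl⟩, rfl⟩ := hx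
    have := (C.2 l).2
    simp [encodeField]
  induction Cs with
  | nil => simp [encodeList]
  | cons C Cs ih =>
    have := h C
    simp only [encodeList, List.map_cons, List.flatten_cons, List.length_append,
      List.length_cons] at ih ⊢
    rw [add_mul]
    omega

/-- The distribution of the examples that are drawn from a list of constraints. -/
def drawDist {K n : ℕ} (q : ℕ) (Cs : List (Constraint K n)) : PMF ((Fin n → Bool) × Bool) :=
  (randomBits q 0).map fun v => headExample (Cs.drop v)

/-- A bound on the running time of `parse`. -/
def parseTime (K n : ℕ) : ℕ := 30 * n + 20 + K * (20 * n + 41)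

/-- Parsing `v` more times discards `v` constraints, since each call overwrites the current example.
Past the end it settles on the padding example. -/
theorem det_skipExamples {K n : ℕ} (hK : 0 < K) (a1 a8 a9 a10 a11 : List Bool) (s : Store)
    (Cs : List (Constraint K n)) (v : ℕ) :
    Det (Prog.loop 7 (Prog.seq (Prog.pop 7) (parse K)))
      (mem (List.replicate n false) a1 (encodeList Cs.tail) (List.ofFn (headExample Cs).1)
        [(headExample Cs).2] [] [] (unary v) a8 a9 a10 a11 s)
      (v * (parseTime K n + 3) + 1)
      (mem (List.replicate n false) a1 (encodeList (Cs.drop v).tail)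
        (List.ofFn (headExample (Cs.drop v)).1)
        [(headExample (Cs.drop v)).2] [] [] [] a8 a9 a10 a11 s) := by
  induction v generalizing Cs with
  | zero => exact (Det.loop_nil rfl).mono (by omega)
  | succ v ih =>
    have h₁ := Det.straight (c := Prog.pop 7) (by simp [Straight])
      (mem (List.replicate n false) a1 (encodeList Cs.tail) (List.ofFn (headExample Cs).1)
        [(headExample Cs).2] [] [] (unary (v + 1)) a8 a9 a10 a11 s)
    simp only [ev, mem_apply_7, unary_succ, List.tail_cons, update_mem_7] at h₁
    have h₂ := det_parse a1 (unary v) a8 a9 a10 a11 s hK Cs.tail (List.ofFn (headExample Cs).1)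
      [(headExample Cs).2] (by simp) (by simp)
    have h₃ := ih Cs.tail
    rw [show Cs.tail.drop v = Cs.drop (v + 1) by cases Cs <;> simp] at h₃
    refine (Det.loop_cons (by simp [unary]) (h₁.seq h₂) h₃).mono ?_
    simp only [psize, parseTime]
    ring_nf
    omega

/-- A bound on the running time of `drawExample`. -/
def drawTime (K n m q : ℕ) : ℕ :=
  20 * q + q * (25 * 2 ^ q + 20) + 30 * (m * (K * (n + 2))) + (2 ^ q + 1) * (parseTime K n + 3)
    + 20 * n + 100

theorem randomBits_support_lt {q v w : ℕ} (hw : w ∈ (randomBits q v).support) :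
    w < (v + 1) * 2 ^ q := by
  induction q generalizing v with
  | zero =>
    rw [randomBits, PMF.mem_support_pure_iff] at hw
    omega
  | succ q ih =>
    rw [randomBits, PMF.mem_support_bind_iff] at hw
    obtain ⟨b, -, hb⟩ := hw
    refine (ih hb).trans_le ?_
    rw [pow_succ', ← mul_assoc]
    refine Nat.mul_le_mul_right _ ?_
    cases b <;> simp <;> omega

theorem runs_drawExample {K n : ℕ} (hK : 0 < K) (q : ℕ) (Cs : List (Constraint K n)) (r : ℕ)
    (a9 a11 : List Bool) (s : Store) :
    Runs [drawExample K r]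
      (mem (List.replicate n false) (encodeList Cs) [] [] [] [] [] [] (unary q) a9 [] a11 s)
      (drawTime K n Cs.length q)
      (((drawDist q Cs).map fun z => z.2 :: List.ofFn z.1).map fun a =>
        mem (List.replicate n false) (encodeList Cs) [] [] [] [] [] [] (unary q) a9 [] a11
          (Function.update s r (a ++ s r))) := by
  set N := List.replicate n false with hN
  set J := encodeList Cs with hJ
  have hJl : J.length ≤ Cs.length * (K * (n + 2)) := length_encodeList_le Cs
  have h₁ := det_copy (a := 8) (b := 10) (z := 5) (by simp) (by simp) (by simp)
    (mem N J [] [] [] [] [] [] (unary q) a9 [] a11 s) (by simp)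
  simp only [mem_apply_8, mem_apply_10, update_mem_10, List.append_nil, length_unary] at h₁
  have h₂ := runs_drawIndex N J [] [] [] (unary q) a9 a11 s (2 ^ q) q 0 (by simp)
  rw [drawDist, PMF.map_comp, PMF.map_comp]
  refine (Runs.seq_det h₁ (Runs.det_map h₂ (t₂ := 30 * (Cs.length * (K * (n + 2))) +
    (2 ^ q + 1) * (parseTime K n + 3) + 20 * n + 50) fun v hv => ?_)).mono ?_
  · have hv' := randomBits_support_lt hv
    rw [zero_add, one_mul] at hv'
    have h₃ := det_copy (a := 1) (b := 2) (z := 5) (by simp) (by simp) (by simp)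
      (mem N J [] [] [] [] [] (unary v) (unary q) a9 [] a11 s) (by simp)
    simp only [mem_apply_1, mem_apply_2, update_mem_2, List.append_nil] at h₃
    have h₄ := det_parse J (unary v) (unary q) a9 [] a11 s hK Cs [] [] (by simp) (by simp)
    have h₅ := det_skipExamples hK J (unary q) a9 [] a11 s Cs v
    set z := headExample (Cs.drop v) with hz
    have h₆ := det_clear 2 (mem N J (encodeList (Cs.drop v).tail) (List.ofFn z.1) [z.2] [] [] []
      (unary q) a9 [] a11 s)
    have h₇ := det_move (a := 3) (b := 5) (by simp) (mem N J [] (List.ofFn z.1) [z.2] [] [] []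
      (unary q) a9 [] a11 s)
    have h₈ := det_move (a := 5) (b := r + 12) (by omega) (mem N J [] [] [z.2]
      (List.ofFn z.1).reverse [] [] (unary q) a9 [] a11 s)
    have h₉ := det_move (a := 4) (b := r + 12) (by omega) (mem N J [] [] [z.2] [] [] []
      (unary q) a9 [] a11 (Function.update s r (List.ofFn z.1 ++ s r)))
    simp only [mem_apply_2, update_mem_2, mem_apply_3, update_mem_3, mem_apply_5, update_mem_5,
      List.append_nil, List.reverse_reverse, mem_apply_add, update_mem_add, mem_apply_4,
      update_mem_4, List.reverse_singleton, List.singleton_append, Function.update_self,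
      Function.update_idem] at h₆ h₇ h₈ h₉
    refine Eq.subst (motive := fun s' => Runs _ _ _ (PMF.pure s')) ?_
      ((h₃.seq (h₄.seq (h₅.seq (h₆.seq (h₇.seq (h₈.seq h₉)))))).mono ?_)
    · rfl
    · have h10 := length_encodeList_le (Cs.drop v).tail
      have h11 : ((Cs.drop v).tail.length * (K * (n + 2))) ≤ Cs.length * (K * (n + 2)) :=
        Nat.mul_le_mul_right _ (by simp)
      have h12 : v * (parseTime K n + 3) ≤ 2 ^ q * (parseTime K n + 3) :=
        Nat.mul_le_mul_right _ hv'.le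
      rw [add_mul (2 ^ q)]
      simp only [List.length_ofFn, List.length_reverse, List.length_singleton]
      simp only [parseTime] at h12 ⊢
      omega
  · simp only [drawTime]
    omega

/-! ### Setting up the registers -/

def halve : Prog Unit :=
  Prog.loop 3 (Prog.seq (Prog.pop 3) (Prog.branch 3 Prog.skip
    (Prog.seq (Prog.pop 3) (Prog.push 5 true)) (Prog.seq (Prog.pop 3) (Prog.push 5 true))))

/-- Halving `n` down to zero takes `n.size` rounds, each contributing `d` marks; so `q = d *
n.size`, which makes `2^q` comparable to `n^d`. -/
def countBits (d : ℕ) : Prog Unit :=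
  Prog.loop 3 (Prog.seq halve (Prog.seq (move 5 3) (pushList 8 (unary d))))

def copyInput : Prog Unit :=
  Prog.loop 0 (Prog.seq (Prog.pop 0)
    (Prog.seq (Prog.push 12 true) (Prog.seq (Prog.push 5 false) (Prog.push 3 true))))

/-- Put the constants for sampling in place, and the input of the learning algorithm in the registers
from `12` on. -/
def setup (d s t : ℕ) : Prog Unit :=
  Prog.seq copyInput (Prog.seq (move 5 0) (Prog.seq (countBits d)
    (Prog.seq (pushList 13 (unary s)) (pushList 14 (unary t)))))

section

variable (a0 a1 a2 a4 a5 a7 a8 a9 a10 a11 : List Bool) (s : Store)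

theorem det_halve (h e : ℕ) :
    Det halve (mem a0 a1 a2 (unary h) a4 (unary e) [] a7 a8 a9 a10 a11 s) (10 * h + 1)
      (mem a0 a1 a2 [] a4 (unary (e + h / 2)) [] a7 a8 a9 a10 a11 s) := by
  have hst : Straight (Prog.seq (Prog.pop 3) (Prog.branch 3 Prog.skip
      (Prog.seq (Prog.pop 3) (Prog.push 5 true)) (Prog.seq (Prog.pop 3) (Prog.push 5 true)))) := by
    simp [Straight]
  induction h using Nat.strong_induction_on generalizing e with
  | _ h ih =>
    rcases h with _ | _ | h
    · exact (Det.loop_nil rfl).mono (by omega)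
    · have h₁ := Det.loop_cons (r := 3) (by simp [unary]) (Det.straight hst
        (mem a0 a1 a2 (unary 1) a4 (unary e) [] a7 a8 a9 a10 a11 s)) (Det.loop_nil rfl)
      simp only [ev, mem_apply_3, unary, List.replicate_one, List.tail_cons, update_mem_3,
        select] at h₁
      exact h₁.mono (by simp [psize])
    · have h₁ := Det.loop_cons (r := 3) (by simp [unary]) (Det.straight hst
        (mem a0 a1 a2 (unary (h + 2)) a4 (unary e) [] a7 a8 a9 a10 a11 s)) (t₂ := 10 * h + 1)
        (s'' := mem a0 a1 a2 [] a4 (unary (e + 1 + h / 2)) [] a7 a8 a9 a10 a11 s) (by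
          simpa [ev, unary_succ, select, halve] using ih h (by omega) (e + 1))
      rw [show e + (h + 1 + 1) / 2 = e + 1 + h / 2 by omega]
      exact h₁.mono (by simp [psize]; omega)

theorem size_half {h : ℕ} (hh : h ≠ 0) : Nat.size h = Nat.size (h / 2) + 1 := by
  have h₁ := Nat.bit_bodd_div2 h
  have h₂ := Nat.size_bit (b := h.bodd) (n := h.div2) (by rwa [h₁])
  rwa [h₁, Nat.div2_val] at h₂

theorem det_countBits (d h e n : ℕ) (hn : h ≤ n) :
    Det (countBits d) (mem a0 a1 a2 (unary h) a4 [] [] a7 (unary e) a9 a10 a11 s)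
      (h * (20 * n + 2 * d + 10) + 1)
      (mem a0 a1 a2 [] a4 [] [] a7 (unary (e + d * h.size)) a9 a10 a11 s) := by
  induction h using Nat.strong_induction_on generalizing e with
  | _ h ih =>
    by_cases hh : h = 0
    · subst hh
      exact (Det.loop_nil rfl).mono (by omega)
    · have h₁ := det_halve a0 a1 a2 a4 a7 (unary e) a9 a10 a11 s h 0
      have h₂ := det_move (a := 5) (b := 3) (by simp)
        (mem a0 a1 a2 [] a4 (unary (0 + h / 2)) [] a7 (unary e) a9 a10 a11 s)
      have h₃ := det_pushList 8 (unary d)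
        (mem a0 a1 a2 (unary (0 + h / 2)) a4 [] [] a7 (unary e) a9 a10 a11 s)
      simp only [mem_apply_5, mem_apply_3, update_mem_5, update_mem_3, reverse_unary,
        List.append_nil, mem_apply_8, update_mem_8, unary_append, length_unary] at h₂ h₃
      have h₄ := ih (h / 2) (by omega) (d + e) (by omega)
      rw [size_half hh, show e + d * ((h / 2).size + 1) = d + e + d * (h / 2).size by ring]
      rw [zero_add] at h₁ h₂ h₃
      refine (Det.loop_cons (r := 3) (by simpa using unary_ne_nil hh) (h₁.seq (h₂.seq h₃)) h₄).mono ?_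
      have h₅ : h / 2 * (20 * n + 2 * d + 10) + (20 * n + 2 * d + 10) ≤
          h * (20 * n + 2 * d + 10) := by
        rw [← Nat.succ_mul]
        exact Nat.mul_le_mul_right _ (by omega)
      omega

theorem det_copyInput (n : ℕ) :
    Det copyInput (mem (unary n) a1 a2 [] a4 [] [] a7 a8 a9 a10 a11 s) (n * 8 + 1)
      (mem [] a1 a2 (unary n) a4 (List.replicate n false) [] a7 a8 a9 a10 a11
        (Function.update s 0 (unary n ++ s 0))) := by
  have h := Det.loop (r := 0) (t := 7) (c := Prog.seq (Prog.pop 0)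
    (Prog.seq (Prog.push 12 true) (Prog.seq (Prog.push 5 false) (Prog.push 3 true))))
    (fun i => mem (unary (n - i)) a1 a2 (unary i) a4 (List.replicate i false) [] a7 a8 a9 a10 a11
        (Function.update s 0 (unary i ++ s 0))) n
    (fun i hi => unary_ne_nil (by omega)) (by simp [unary]) (fun i hi => by
      obtain ⟨j, hj⟩ : ∃ j, n - i = j + 1 := ⟨n - i - 1, by omega⟩
      have h := Det.straight (c := Prog.seq (Prog.pop 0)
        (Prog.seq (Prog.push 12 true) (Prog.seq (Prog.push 5 false) (Prog.push 3 true))))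
        (by simp [Straight])
        (mem (unary (n - i)) a1 a2 (unary i) a4 (List.replicate i false) [] a7 a8 a9 a10 a11
        (Function.update s 0 (unary i ++ s 0)))
      simpa [ev, hj, unary_succ, psize, List.replicate_succ,
        show n - (i + 1) = j by omega] using h)
  simpa [unary, copyInput] using h

end

theorem load_pair (l₀ l₁ : List Bool) :
    load [l₀, l₁] = mem l₀ l₁ [] [] [] [] [] [] [] [] [] [] (fun _ => []) := by
  funext r
  rcases r with _ | _ | r
  · rfl
  · rfl
  · have : load [l₀, l₁] (r + 2) = [] := by simp [load]
    rw [this]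
    by_cases h : r + 2 < 12
    · obtain ⟨i, rfl⟩ : ∃ i : Fin 10, (i : ℕ) = r := ⟨⟨r, by omega⟩, rfl⟩
      fin_cases i <;> rfl
    · simp [mem, join, h]

theorem update_load_three (l₀ l₁ l₂ : List Bool) :
    Function.update (Function.update (Function.update (fun _ => []) 0 l₀) 1 l₁) 2 l₂ =
      load [l₀, l₁, l₂] := by
  funext r
  rcases r with _ | _ | _ | r <;> simp [load]

theorem update_load_two (l₀ l₁ : List Bool) :
    Function.update (Function.update (fun _ => []) 0 l₀) 1 l₁ = load [l₀, l₁] := by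
  funext r
  rcases r with _ | _ | r <;> simp [load]

theorem det_setup (d n s t : ℕ) (J : List Bool) :
    Det (setup d s t) (load [unary n, J])
      (16 * n + n * (20 * n + 2 * d + 10) + 2 * s + 2 * t + 20)
      (mem (List.replicate n false) J [] [] [] [] [] [] (unary (d * n.size)) [] [] []
        (load [unary n, unary s, unary t])) := by
  rw [load_pair]
  have h₁ := det_copyInput J [] [] [] [] [] [] [] (fun _ => []) n
  have h₂ := det_move (a := 5) (b := 0) (by simp) (mem [] J [] (unary n) [] (List.replicate n false)
    [] [] [] [] [] [] (Function.update (fun _ => []) 0 (unary n)))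
  have h₃ := det_countBits (List.replicate n false) J [] [] [] [] [] []
    (Function.update (fun _ => []) 0 (unary n)) d n 0 n le_rfl
  have h₄ := det_pushList 13 (unary s)
    (mem (List.replicate n false) J [] [] [] [] [] [] (unary (0 + d * n.size)) [] [] []
    (Function.update (fun _ => []) 0 (unary n)))
  have h₅ := det_pushList 14 (unary t)
    (mem (List.replicate n false) J [] [] [] [] [] [] (unary (0 + d * n.size)) [] [] []
    (Function.update (Function.update (fun _ => []) 0 (unary n)) 1 (unary s)))
  rw [← update_load_three]
  simp only [mem_apply_5, mem_apply_0, update_mem_5, update_mem_0, mem_apply_13, update_mem_13,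
    mem_apply_14, update_mem_14, List.append_nil, List.reverse_replicate, zero_add,
    Function.update_of_ne (show (1 : ℕ) ≠ 0 by simp), length_unary, List.length_replicate,
    Function.update_of_ne (show (2 : ℕ) ≠ 0 by simp),
    Function.update_of_ne (show (2 : ℕ) ≠ 1 by simp)] at h₁ h₂ h₃ h₄ h₅
  refine (h₁.seq (h₂.seq (h₃.seq (h₄.seq h₅)))).mono ?_
  omega

/-! ### Evaluating the hypothesis on all constraints -/

/-- Register `12` holds the predicted bit and `4` the label. Agreement is tallied in `10`,
disagreement in `11`. -/
def compareLabel : Prog Unit :=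
  Prog.branch 12 Prog.skip
    (Prog.branch 4 Prog.skip (Prog.push 10 true) (Prog.push 11 true))
    (Prog.branch 4 Prog.skip (Prog.push 11 true) (Prog.push 10 true))

/-- The translation of a deterministic program. -/
def translateDet (E : Prog Empty) : Prog Unit := translate (fun _ _ => Prog.skip) E

def evalExample (K W : ℕ) (E : Prog Empty) : Prog Unit :=
  Prog.seq (parse K) (Prog.seq (copy 9 12 5) (Prog.seq (move 3 5) (Prog.seq (move 5 13)
    (Prog.seq (translateDet E) (Prog.seq compareLabel (Prog.seq (clear 4) (clearAll W)))))))

/-- Three correct marks are cancelled for every wrong one. Something survives exactly when correct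
`> 3 ·` wrong, that is, when fewer than a quarter of the constraints are misclassified. -/
def answer : Prog Unit :=
  Prog.seq (Prog.loop 11 (Prog.seq (Prog.pop 11)
      (Prog.seq (Prog.pop 10) (Prog.seq (Prog.pop 10) (Prog.pop 10)))))
    (Prog.seq (clear 0) (Prog.branch 10 (Prog.push 0 false) (Prog.push 0 true) (Prog.push 0 true)))

theorem runs_translateDet (E : Prog Empty) (T : ℕ) (P : Fin 12 → List Bool) (l : List (List Bool))
    (h : ∀ c ∈ (exec noOracle E l T).support, c.1 = []) :
    Runs [translateDet E] (join P (load l)) T ((exec noOracle E l T).map fun c => join P c.2) := by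
  have := Runs.translate (B := 1) (o := noOracle) (P := P) (sub := fun _ _ => Prog.skip) le_rfl
    (fun _ q => q.elim) T [E] (load l) h
  rw [mul_one] at this
  exact this

/-- A bound on the running time of `evalExample`. -/
def evalTime (K n ℓ T W : ℕ) : ℕ :=
  parseTime K n + 20 * ℓ + 20 * n + T + W * (2 * (ℓ + n + T) + 3) + 60

theorem det_evalExample {K n : ℕ} (hK : 0 < K) {W : ℕ} {E : Prog Empty} (hW : 2 ≤ W)
    (hE : regBound E ≤ W) (a1 a7 a8 w : List Bool) (T i j : ℕ) {h : (Fin n → Bool) → Bool}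
    (hw : Describes E T w h) (Cs : List (Constraint K n)) :
    Det (evalExample K W E)
      (mem (List.replicate n false) a1 (encodeList Cs) [] [] [] [] a7 a8 w (unary i) (unary j)
        (fun _ => []))
      (evalTime K n w.length T W)
      (mem (List.replicate n false) a1 (encodeList Cs.tail) [] [] [] [] a7 a8 w
        (unary (i + if h (headExample Cs).1 = (headExample Cs).2 then 1 else 0))
        (unary (j + if h (headExample Cs).1 = (headExample Cs).2 then 0 else 1)) (fun _ => [])) := by
  set N := List.replicate n false with hN
  have h₁ := det_parse a1 a7 a8 w (unary i) (unary j) (fun _ => []) hK Cs [] [] (by simp) (by simp)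
  set z := headExample Cs with hz
  set J := encodeList Cs.tail with hJ
  have h₂ := det_copy (a := 9) (b := 12) (z := 5) (by simp) (by simp) (by simp)
    (mem N a1 J (List.ofFn z.1) [z.2] [] [] a7 a8 w (unary i) (unary j) (fun _ => [])) (by simp)
  have h₃ := det_move (a := 3) (b := 5) (by simp)
    (mem N a1 J (List.ofFn z.1) [z.2] [] [] a7 a8 w (unary i) (unary j)
      (Function.update (fun _ => []) 0 w))
  have h₄ := det_move (a := 5) (b := 13) (by simp)
    (mem N a1 J [] [z.2] (List.ofFn z.1).reverse [] a7 a8 w (unary i) (unary j)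
      (Function.update (fun _ => []) 0 w))
  simp only [mem_apply_9, mem_apply_12, update_mem_12, mem_apply_3, update_mem_3, mem_apply_5,
    update_mem_5, List.append_nil, mem_apply_13, update_mem_13, List.reverse_reverse,
    Function.update_of_ne (show (1 : ℕ) ≠ 0 by simp), update_load_two] at h₂ h₃ h₄
  have h₅ := runs_translateDet E T ![N, a1, J, [], [z.2], [], [], a7, a8, w, unary i, unary j]
    [w, List.ofFn z.1] (fun c hc => (hw z.1 c hc).1)
  have h₆ : ∀ c ∈ (exec noOracle E [w, List.ofFn z.1] T).support,
      Runs [Prog.seq compareLabel (Prog.seq (clear 4) (clearAll W))]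
        (mem N a1 J [] [z.2] [] [] a7 a8 w (unary i) (unary j) c.2)
        (W * (2 * (w.length + n + T) + 3) + 20)
        (PMF.pure (mem N a1 J [] [] [] [] a7 a8 w
        (unary (i + if h z.1 = z.2 then 1 else 0))
        (unary (j + if h z.1 = z.2 then 0 else 1)) (fun _ => []))) := by
    intro c hc
    obtain ⟨-, hout⟩ := hw z.1 c hc
    have hsupp := fun r => runFor_support (G := 1) (W := W) (fun q => q.elim) le_rfl T
      (by simpa using hE) hc r
    rw [output] at hout
    have k₁ := Det.straight (c := compareLabel) (by simp [compareLabel, Straight])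
      (mem N a1 J [] [z.2] [] [] a7 a8 w (unary i) (unary j) c.2)
    have k₂ : ev compareLabel (mem N a1 J [] [z.2] [] [] a7 a8 w (unary i) (unary j) c.2) =
        mem N a1 J [] [z.2] [] [] a7 a8 w (unary (i + if h z.1 = z.2 then 1 else 0))
        (unary (j + if h z.1 = z.2 then 0 else 1)) c.2 := by
      cases hh : h z.1 <;> cases hy : z.2 <;>
        simp [compareLabel, ev, hout, hh, select, unary_succ]
    rw [k₂] at k₁
    have k₃ := det_clear 4 (mem N a1 J [] [z.2] [] [] a7 a8 w
      (unary (i + if h z.1 = z.2 then 1 else 0))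
        (unary (j + if h z.1 = z.2 then 0 else 1)) c.2)
    simp only [mem_apply_4, update_mem_4] at k₃
    have k₄ := det_clearAll W (w.length + n + T) ![N, a1, J, [], [], [], [], a7, a8, w,
      (unary (i + if h z.1 = z.2 then 1 else 0)),
      (unary (j + if h z.1 = z.2 then 0 else 1))] c.2 (by
        intro r _
        refine (hsupp r).2.trans ?_
        rcases r with _ | _ | r <;> simp [load])
    -- Registers from `W ≥ 2` on are not named in `E` and were empty at the start, because only
    -- registers `0` and `1` were loaded.
    have k₅ : (fun r => if r < W then [] else c.2 r) = fun _ => [] := by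
      funext r
      split_ifs with hr
      · rfl
      · rw [(hsupp r).1 (by omega)]
        obtain ⟨r, rfl⟩ : ∃ r', r = r' + 2 := ⟨r - 2, by omega⟩
        simp [load]
    rw [k₅] at k₄
    refine (k₁.seq (k₃.seq k₄)).mono ?_
    simp [psize, compareLabel]
    omega
  have h₇ := Runs.seq_map h₅ h₆
  -- After the cleanup every final configuration of `E` leads to the same store, so its formal
  -- distribution collapses to a point mass.
  rw [PMF.bind_const] at h₇
  refine Runs.mono (h₁.seq (h₂.seq (h₃.seq (h₄.seq h₇)))) ?_
  simp only [evalTime, parseTime, List.length_ofFn, List.length_reverse]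
  omega

theorem det_evalLoop {K n : ℕ} (hK : 0 < K) {W : ℕ} {E : Prog Empty} (hW : 2 ≤ W)
    (hE : regBound E ≤ W) (a1 a7 a8 w : List Bool) (T : ℕ) {h : (Fin n → Bool) → Bool}
    (hw : Describes E T w h) (Cs : List (Constraint K n)) (i j : ℕ) :
    Det (Prog.loop 2 (evalExample K W E))
      (mem (List.replicate n false) a1 (encodeList Cs) [] [] [] [] a7 a8 w (unary i) (unary j)
        (fun _ => []))
      (Cs.length * (evalTime K n w.length T W + 1) + 1)
      (mem (List.replicate n false) a1 [] [] [] [] [] a7 a8 w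
        (unary (i + Cs.countP fun C => h C.toExample.1 = C.toExample.2))
        (unary (j + Cs.countP fun C => h C.toExample.1 ≠ C.toExample.2)) (fun _ => [])) := by
  induction Cs generalizing i j with
  | nil => exact (Det.loop_nil rfl).mono (by omega)
  | cons C Cs ih =>
    have h₁ := det_evalExample hK hW hE a1 a7 a8 w T i j hw (C :: Cs)
    have h₂ := ih (i + if h C.toExample.1 = C.toExample.2 then 1 else 0)
      (j + if h C.toExample.1 = C.toExample.2 then 0 else 1)
    have hne : encodeList (C :: Cs) ≠ [] := by
      obtain ⟨K, rfl⟩ : ∃ K', K = K' + 1 := ⟨K - 1, by omega⟩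
      simp [encodeList, Constraint.fields, List.ofFn_succ, encodeField]
    have h₃ := Det.loop_cons (by simpa using hne) h₁ h₂
    refine Eq.subst (motive := fun s' => Det _ _ _ s') ?_ (h₃.mono ?_)
    · by_cases hh : h C.toExample.1 = C.toExample.2 <;> simp [hh, add_assoc, add_comm 1]
    · rw [List.length_cons, add_mul]
      omega

theorem det_answer (a0 a1 a2 a3 a4 a5 a6 a7 a8 a9 : List Bool) (s : Store) (i j : ℕ) :
    ∃ s', Det answer (mem a0 a1 a2 a3 a4 a5 a6 a7 a8 a9 (unary i) (unary j) s)
      (10 * j + 2 * a0.length + 20) s' ∧ s' 0 = [decide (3 * j < i)] := by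
  have h₁ := Det.loop (r := 11) (t := 7) (c := (Prog.seq (Prog.pop 11)
      (Prog.seq (Prog.pop 10) (Prog.seq (Prog.pop 10) (Prog.pop 10)))))
    (fun k => mem a0 a1 a2 a3 a4 a5 a6 a7 a8 a9 (unary (i - 3 * k)) (unary (j - k)) s) j
    (fun k hk => unary_ne_nil (by omega)) (by simp [unary]) (fun k hk => by
      have h := Det.straight (c := (Prog.seq (Prog.pop 11)
        (Prog.seq (Prog.pop 10) (Prog.seq (Prog.pop 10) (Prog.pop 10))))) (by simp [Straight])
        (mem a0 a1 a2 a3 a4 a5 a6 a7 a8 a9 (unary (i - 3 * k)) (unary (j - k)) s)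
      simpa [ev, psize, unary, Nat.sub_sub, mul_add] using h)
  have h₂ := det_clear 0 (mem a0 a1 a2 a3 a4 a5 a6 a7 a8 a9 (unary (i - 3 * j)) [] s)
  have h₃ := Det.straight
    (c := Prog.branch 10 (Prog.push 0 false) (Prog.push 0 true) (Prog.push 0 true))
    (by simp [Straight]) (mem [] a1 a2 a3 a4 a5 a6 a7 a8 a9 (unary (i - 3 * j)) [] s)
  simp only [mul_zero, Nat.sub_zero, Nat.sub_self, mem_apply_0, update_mem_0] at h₁ h₂
  refine ⟨_, (h₁.seq (h₂.seq h₃)).mono ?_, ?_⟩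
  · simp [psize]
    omega
  · by_cases h : 3 * j < i
    · obtain ⟨k, hk⟩ : ∃ k, i - 3 * j = k + 1 := ⟨i - 3 * j - 1, by omega⟩
      simp [ev, hk, unary_succ, select, h]
    · rw [show i - 3 * j = 0 by omega]
      simp [ev, unary, select, h]

/-! ### The reduction -/

def learnSub (K r : ℕ) : LearnQuery → Prog Unit
  | LearnQuery.coin => Prog.ask (r + 12) ()
  | LearnQuery.draw => drawExample K r

/-- Run the learning algorithm `L` on random constraints, and evaluate its hypothesis on all of
them. -/
def reduction (K W d s t : ℕ) (L : Prog LearnQuery) (E : Prog Empty) : Prog Unit :=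
  Prog.seq (setup d s t) (Prog.seq (translate (learnSub K) L) (Prog.seq (move 12 5)
    (Prog.seq (move 5 9) (Prog.seq (clearAll W) (Prog.seq (copy 1 2 5)
      (Prog.seq (Prog.loop 2 (evalExample K W E)) answer))))))

/-- A description determines its hypothesis, which lets a union bound over hypotheses run over bit
strings. -/
theorem Describes.unique {E : Prog Empty} {t : ℕ} {w : List Bool} {n : ℕ}
    {h h' : (Fin n → Bool) → Bool} (hh : Describes E t w h) (hh' : Describes E t w h') : h = h' := by
  funext x
  obtain ⟨c, hc⟩ := (exec noOracle E [w, List.ofFn x] t).support_nonempty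
  simpa using (hh x c hc).2.symm.trans (hh' x c hc).2

theorem learnOracle_support {n : ℕ} {D : PMF ((Fin n → Bool) × Bool)} (q : LearnQuery) :
    ∀ a ∈ (learnOracle D q).support, a.length ≤ n + 1 := by
  intro a ha
  cases q
  · rw [learnOracle, fairCoin, PMF.mem_support_map_iff] at ha
    obtain ⟨b, -, rfl⟩ := ha
    simp
  · rw [learnOracle, PMF.mem_support_map_iff] at ha
    obtain ⟨b, -, rfl⟩ := ha
    simp

/-- Register `0` starts with `n` bits and gains at most `n + 1` per step, the length of an example.
The bound does not involve the number of constraints sampled from, which is decisive for the union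
bound. -/
theorem length_output_le {n s t T : ℕ} {D : PMF ((Fin n → Bool) × Bool)} {L : Prog LearnQuery}
    {c : Config LearnQuery}
    (hc : c ∈ (exec (learnOracle D) L [unary n, unary s, unary t] T).support) :
    (output c).length ≤ n + T * (n + 1) := by
  have := (runFor_support (W := regBound L) learnOracle_support (by omega) T (by simp) hc 0).2
  change (c.2 0).length ≤ _
  simpa [load] using this

/-- A bound on the running time of the reduction. -/
def reductionTime (K W d s t n m T : ℕ) : ℕ :=
  16 * n + n * (20 * n + 2 * d + 10) + 2 * s + 2 * t + T * (drawTime K n m (d * n.size) + 1) +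
    16 * (n + T * (n + 1)) + W * (2 * (n + s + t + T * (n + 1)) + 3) + 20 * (m * (K * (n + 2))) +
    m * (evalTime K n (n + T * (n + 1)) T W + 1) + 10 * m + 2 * n + 100

/-- The final store is obtained as the image of the learner's final configuration under a map `g`:
everything after the learner's run is deterministic. Probabilities of learner events therefore
transfer directly to the answer. -/
theorem runs_reduction {K n W : ℕ} (hK : 0 < K) (d s t T : ℕ) {L : Prog LearnQuery}
    {E : Prog Empty} (hW : 3 ≤ W) (hLW : regBound L ≤ W) (hEW : regBound E ≤ W)
    (Cs : List (Constraint K n))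
    (hL : HaltsWithin (learnOracle (drawDist (d * n.size) Cs)) L [unary n, unary s, unary t] T)
    (hE : ∀ c ∈ (exec (learnOracle (drawDist (d * n.size) Cs)) L
      [unary n, unary s, unary t] T).support,
        ∃ h : (Fin n → Bool) → Bool, Describes E T (output c) h) :
    ∃ g : Config LearnQuery → Store,
      Runs [reduction K W d s t L E] (load [unary n, encodeList Cs])
        (reductionTime K W d s t n Cs.length T)
        ((exec (learnOracle (drawDist (d * n.size) Cs)) L [unary n, unary s, unary t] T).map g) ∧
      ∀ c ∈ (exec (learnOracle (drawDist (d * n.size) Cs)) L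
        [unary n, unary s, unary t] T).support,
          ∀ h : (Fin n → Bool) → Bool, Describes E T (output c) h →
            g c 0 = [decide (3 * (Cs.countP fun C => h C.toExample.1 ≠ C.toExample.2) <
              Cs.countP fun C => h C.toExample.1 = C.toExample.2)] := by
  classical
  set q := d * n.size with hq
  set D := drawDist q Cs with hD
  set N := List.replicate n false with hN
  set J := encodeList Cs with hJ
  set I := [unary n, unary s, unary t] with hI
  have h₁ := det_setup d n s t J
  have h₂ := Runs.translate (o := learnOracle D) (sub := learnSub K)
    (P := ![N, J, [], [], [], [], [], [], unary q, [], [], []])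
    (B := drawTime K n Cs.length q + 1) (by omega) (by
      intro r a s'
      cases a
      · refine Runs.mono (t := 1) ?_ (by omega)
        have := Runs.ask (s := join ![N, J, [], [], [], [], [], [], unary q, [], [], []] s')
          (r + 12)
        simp only [update_join_add, join_add] at this
        exact this
      · exact (runs_drawExample hK q Cs r [] [] s').mono (by omega)) T [L] (load I) hL
  have h₃ : ∀ c ∈ (exec (learnOracle D) L I T).support, ∃ s',
      Det (Prog.seq (move 12 5) (Prog.seq (move 5 9) (Prog.seq (clearAll W) (Prog.seq (copy 1 2 5)
        (Prog.seq (Prog.loop 2 (evalExample K W E)) answer)))))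
        (mem N J [] [] [] [] [] [] (unary q) [] [] [] c.2)
        (16 * (n + T * (n + 1)) + W * (2 * (n + s + t + T * (n + 1)) + 3) +
          20 * (Cs.length * (K * (n + 2))) +
          Cs.length * (evalTime K n (n + T * (n + 1)) T W + 1) + 10 * Cs.length + 2 * n + 60) s' ∧
      ∀ h : (Fin n → Bool) → Bool, Describes E T (output c) h →
            s' 0 = [decide (3 * (Cs.countP fun C => h C.toExample.1 ≠ C.toExample.2) <
              Cs.countP fun C => h C.toExample.1 = C.toExample.2)] := by
    intro c hc
    obtain ⟨h, hh⟩ := hE c hc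
    have hlen := length_output_le hc
    have hsupp := fun r => runFor_support (W := W) learnOracle_support (by omega) T
      (by simpa using hLW) hc r
    have k₁ := det_move (a := 12) (b := 5) (by simp)
      (mem N J [] [] [] [] [] [] (unary q) [] [] [] c.2)
    have k₂ := det_move (a := 5) (b := 9) (by simp)
      (mem N J [] [] [] (output c).reverse [] [] (unary q) [] [] [] (Function.update c.2 0 []))
    have k₃ := det_clearAll W (n + s + t + T * (n + 1))
      ![N, J, [], [], [], [], [], [], (unary q), output c, [], []] (Function.update c.2 0 []) (by
        intro r _
        by_cases hr : r = 0
        · subst hr; simp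
        · rw [Function.update_of_ne hr]
          refine (hsupp r).2.trans ?_
          have : (load I r).length ≤ n + s + t := by
            rcases r with _ | _ | _ | r <;> simp [load, hI] <;> omega
          simpa using this)
    have k₄ : (fun r => if r < W then [] else Function.update c.2 0 [] r) = fun _ => [] := by
      funext r
      split_ifs with hr
      · rfl
      · rw [Function.update_of_ne (by omega), (hsupp r).1 (by omega)]
        obtain ⟨r, rfl⟩ : ∃ r', r = r' + 3 := ⟨r - 3, by omega⟩
        simp [load, hI]
    rw [k₄] at k₃
    have k₅ := det_copy (a := 1) (b := 2) (z := 5) (by simp) (by simp) (by simp)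
      (mem N J [] [] [] [] [] [] (unary q) (output c) [] [] (fun _ => [])) (by simp)
    have hout : c.2 0 = output c := rfl
    simp only [mem_apply_12, mem_apply_5, mem_apply_9, mem_apply_1, mem_apply_2, update_mem_12,
      update_mem_5, update_mem_9, update_mem_2, List.append_nil, List.reverse_reverse,
      List.length_reverse, hout] at k₁ k₂ k₅
    have k₆ := det_evalLoop hK (by omega : 2 ≤ W) hEW J [] (unary q) (output c) T hh Cs 0 0
    simp only [zero_add] at k₆
    obtain ⟨s', k₇, k₈⟩ := det_answer N J [] [] [] [] [] [] (unary q) (output c) (fun _ => [])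
      (Cs.countP fun C => h C.toExample.1 = C.toExample.2)
      (Cs.countP fun C => h C.toExample.1 ≠ C.toExample.2)
    refine ⟨s', (k₁.seq (k₂.seq (k₃.seq (k₅.seq (k₆.seq k₇))))).mono ?_, fun h' hh' => ?_⟩
    · have e₁ := length_encodeList_le Cs
      rw [← hJ] at e₁
      have e₂ : Cs.length * (evalTime K n (output c).length T W + 1) ≤
          Cs.length * (evalTime K n (n + T * (n + 1)) T W + 1) := by
        unfold evalTime
        gcongr
      have e₃ := List.countP_le_length (l := Cs)
        (p := fun C => decide (h C.toExample.1 ≠ C.toExample.2))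
      simp only [hN, List.length_replicate]
      omega
    · rw [hh'.unique hh, k₈]
  choose! g hg₁ hg₂ using h₃
  refine ⟨g, ?_, hg₂⟩
  have h₄ := Runs.seq_det h₁ (Runs.det_map h₂ hg₁)
  refine h₄.mono ?_
  simp only [reductionTime, ← hq]
  omega

/-! ### Parities -/

def bit (b : Bool) : ZMod 2 := if b then 1 else 0

theorem bit_injective : Function.Injective bit := by decide

theorem bit_xor (a b : Bool) : bit (xor a b) = bit a + bit b := by revert a b; decide

theorem bit_not (a : Bool) : bit (!a) = bit a + 1 := by revert a; decide

theorem bit_chi {n : ℕ} (S : Finset (Fin n)) (x : Fin n → Bool) :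
    bit (chi S x) = ∑ i ∈ S, bit (x i) := by
  simp only [bit, chi, decide_eq_true_eq]
  rw [Finset.sum_boole]
  split_ifs with h
  · rw [ZMod.natCast_eq_one_iff_odd.2 h]
  · rw [ZMod.natCast_eq_zero_iff_even.2 (Nat.not_odd_iff_even.1 h)]

theorem bit_foldl_xor (a : Bool) (l : List Bool) :
    bit (l.foldl xor a) = bit a + (l.map bit).sum := by
  induction l generalizing a with
  | nil => simp
  | cons b l ih => rw [List.foldl_cons, ih, bit_xor, List.map_cons, List.sum_cons, add_assoc]

/-- Over `ZMod 2` the left side says `∑ b + ∑ x = 1` and the right side `∑ x = 1 + ∑ b`, with `x`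
summed over the variables of the constraint. As these are distinct, the indicator vector counts each
of them once. -/
theorem eval_eq_true_iff {K n : ℕ} (C : Constraint K n) (x : Fin n → Bool) :
    C.eval (chi Finset.univ) x = true ↔
      chi (Finset.univ.filter fun i => x i = true) C.toExample.1 = C.toExample.2 := by
  have h₁ : bit (C.eval (chi Finset.univ) x) = ∑ l, bit (C.1 l) + ∑ l, bit (x (C.2 l)) := by
    rw [Constraint.eval, bit_chi, ← Finset.sum_add_distrib]
    exact Finset.sum_congr rfl fun l _ => bit_xor _ _
  have h₂ : bit C.toExample.2 = 1 + ∑ l, bit (C.1 l) := by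
    rw [Constraint.toExample, bit_foldl_xor, List.map_ofFn, List.sum_ofFn]
    rfl
  have h₃ : bit (chi (Finset.univ.filter fun i => x i = true) C.toExample.1) =
      ∑ l, bit (x (C.2 l)) := by
    rw [bit_chi, Finset.sum_filter, ← Finset.sum_map Finset.univ C.2 fun i => bit (x i)]
    rw [← Finset.sum_filter_add_sum_filter_not Finset.univ (fun i => i ∈ Finset.univ.map C.2)]
    rw [Finset.filter_mem_eq_inter, Finset.univ_inter, add_eq_left.2]
    · refine Finset.sum_congr rfl fun i hi => ?_
      rw [Finset.mem_map] at hi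
      obtain ⟨l, -, rfl⟩ := hi
      simp only [Constraint.toExample, bit]
      by_cases h : x (C.2 l) = true <;> simp [h]
    · refine Finset.sum_eq_zero fun i hi => ?_
      have : ¬ ∃ l, C.2 l = i := by simpa using hi
      simp [Constraint.toExample, bit, this]
  rw [← bit_injective.eq_iff, ← bit_injective.eq_iff, h₁, h₂, h₃]
  change _ = (1 : ZMod 2) ↔ _
  generalize ∑ l, bit (C.1 l) = a
  generalize ∑ l, bit (x (C.2 l)) = b
  revert a b
  decide

/-- Change one bit. -/
def flip {K : ℕ} (i : Fin K) (x : Fin K → Bool) : Fin K → Bool := Function.update x i (!x i)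

theorem flip_flip {K : ℕ} (i : Fin K) (x : Fin K → Bool) : flip i (flip i x) = x := by
  simp [flip]

theorem chi_flip {K : ℕ} (i : Fin K) (x : Fin K → Bool) :
    chi Finset.univ (flip i x) = !chi Finset.univ x := by
  apply bit_injective
  rw [bit_not, bit_chi, bit_chi, ← Finset.add_sum_erase _ _ (Finset.mem_univ i),
    ← Finset.add_sum_erase _ (fun j => bit (x j)) (Finset.mem_univ i)]
  have : ∑ j ∈ Finset.univ.erase i, bit (flip i x j) = ∑ j ∈ Finset.univ.erase i, bit (x j) :=
    Finset.sum_congr rfl fun j hj => by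
      rw [flip, Function.update_of_ne (Finset.ne_of_mem_erase hj)]
  rw [this, flip, Function.update_self, bit_not]
  ring

theorem chi_false {K : ℕ} : chi Finset.univ (fun _ : Fin K => false) = false := by simp [chi]

theorem exists_chi_true {K : ℕ} (hK : 0 < K) : ∃ x : Fin K → Bool, chi Finset.univ x = true :=
  ⟨flip ⟨0, hK⟩ fun _ => false, by rw [chi_flip, chi_false, Bool.not_false]⟩

/-- Flipping any variable left free changes the parity, so an assignment forcing `0` must fix all
variables. -/
theorem le_VAR0_chi (K : ℕ) : K ≤ VAR0 (chi (Finset.univ : Finset (Fin K))) := by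
  -- Nonemptiness is needed because the infimum of the empty set in `ℕ` is `0`; the all-zero
  -- assignment provides it.
  refine le_csInf ⟨K, Finset.univ, fun _ => false, by simp, fun x hx => ?_⟩ ?_
  · rw [show x = fun _ => false from funext fun i => hx i (Finset.mem_univ i), chi_false]
  · rintro r ⟨A, a, rfl, h⟩
    by_contra! hA
    obtain ⟨i, hi⟩ : ∃ i, i ∉ A := by
      by_contra! h'
      rw [Finset.eq_univ_iff_forall.2 h', Finset.card_univ, Fintype.card_fin] at hA
      exact lt_irrefl _ hA
    have h₁ := h a fun _ _ => rfl
    have h₂ := h (flip i a) fun j hj => by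
      rw [flip, Function.update_of_ne (fun e : j = i => hi (e ▸ hj))]
    rw [chi_flip, h₁] at h₂
    exact absurd h₂ (by simp)

/-- The witness is the uniform distribution on odd strings. Flipping coordinate `i` or `j` together
with a third coordinate preserves the parity, hence permutes the support, so the four masses for the
pair `i, j` are equal. -/
theorem one_le_Uval_chi {K : ℕ} (hK : 3 ≤ K) :
    1 ≤ Uval (chi (Finset.univ : Finset (Fin K))) := by
  classical
  set O := Finset.univ.filter fun x : Fin K → Bool => chi Finset.univ x = true with hO
  have hO0 : (O.card : ℝ) ≠ 0 := by
    obtain ⟨x, hx⟩ := exists_chi_true (K := K) (by omega)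
    exact_mod_cast Finset.card_ne_zero_of_mem (a := x) (by simp [hO, hx])
  set w : (Fin K → Bool) → ℝ := fun x => if chi Finset.univ x = true then (O.card : ℝ)⁻¹ else 0
    with hw
  have hsumO : ∑ x ∈ O, w x = 1 := by
    rw [Finset.sum_congr rfl (g := fun _ => (O.card : ℝ)⁻¹)
      (fun x hx => if_pos (Finset.mem_filter.1 hx).2), Finset.sum_const, nsmul_eq_mul,
      mul_inv_cancel₀ hO0]
  have hsum : ∑ x, w x = 1 := by
    rw [← hsumO, hO, Finset.sum_filter]
    refine Finset.sum_congr rfl fun x _ => ?_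
    by_cases h : chi Finset.univ x = true <;> simp [hw, h]
  refine le_csSup ⟨1, ?_⟩ ⟨w, ⟨fun x => ?_, hsum⟩, ?_, hsumO.symm⟩
  · rintro v ⟨w', hw', -, rfl⟩
    rw [← hw'.2]
    exact Finset.sum_le_sum_of_subset_of_nonneg (Finset.subset_univ _) fun x _ _ => hw'.1 x
  · simp only [hw]
    split_ifs <;> positivity
  · intro i j hij
    -- The only use of `K ≥ 3`; for `K = 2` the two bits of an odd string determine each other.
    obtain ⟨k, hki, hkj⟩ : ∃ k : Fin K, k ≠ i ∧ k ≠ j := by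
      have : ({i, j} : Finset (Fin K)).card < Fintype.card (Fin K) := by
        refine (Finset.card_le_two).trans_lt ?_
        rw [Fintype.card_fin]; omega
      obtain ⟨k, hk⟩ := Finset.exists_mem_notMem_of_card_lt_card (s := {i, j}) (t := Finset.univ)
        (by simpa using this)
      simp only [Finset.mem_insert, Finset.mem_singleton, not_or] at hk
      exact ⟨k, hk.2.1, hk.2.2⟩
    set S : Bool → Bool → ℝ := fun a b =>
      ∑ x ∈ Finset.univ.filter (fun x : Fin K → Bool => x i = a ∧ x j = b), w x with hS
    have hwf : ∀ i x, w (flip k (flip i x)) = w x := by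
      intro i x
      simp only [hw, chi_flip, Bool.not_not]
    have hmove : ∀ (i' : Fin K) (a b a' b' : Bool), k ≠ i' →
        (∀ x : Fin K → Bool, flip k (flip i' x) i = a' ∧ flip k (flip i' x) j = b' ↔
          x i = a ∧ x j = b) → S a b = S a' b' := by
      intro i' a b a' b' hk h
      simp only [hS]
      have hinv : ∀ x : Fin K → Bool, flip k (flip i' (flip k (flip i' x))) = x := by
        intro x
        funext l
        simp only [flip]
        by_cases h1 : l = k <;> by_cases h2 : l = i' <;> simp_all [Function.update_apply]
      refine Finset.sum_nbij' (fun x => flip k (flip i' x)) (fun x => flip k (flip i' x))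
        (fun x hx => ?_) (fun x hx => ?_) (fun x _ => hinv x) (fun x _ => hinv x)
        (fun x _ => (hwf i' x).symm)
      · simpa only [Finset.mem_filter, Finset.mem_univ, true_and, h] using hx
      · simp only [Finset.mem_filter, Finset.mem_univ, true_and] at hx ⊢
        rw [← h, hinv]
        exact hx
    have h₁ : ∀ a b, S a b = S (!a) b := fun a b => hmove i a b (!a) b hki fun x => by
      simp [flip, Function.update_apply, hki.symm, hkj.symm, hij.symm]
    have h₂ : ∀ a b, S a b = S a (!b) := fun a b => hmove j a b a (!b) hkj fun x => by
      simp [flip, Function.update_apply, hki.symm, hkj.symm, hij]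
    have htot : ∑ a, ∑ b, S a b = 1 := by
      rw [← hsum, ← Finset.sum_fiberwise (s := Finset.univ) (g := fun x : Fin K → Bool => x i)]
      refine Finset.sum_congr rfl fun a _ => ?_
      rw [← Finset.sum_fiberwise (g := fun x : Fin K → Bool => x j)]
      refine Finset.sum_congr rfl fun b _ => ?_
      simp only [hS, Finset.filter_filter]
    rw [Fintype.sum_bool, Fintype.sum_bool, Fintype.sum_bool] at htot
    have e₁ := h₁ true true
    have e₂ := h₂ true true
    have e₃ := h₂ false true
    simp only [Bool.not_true] at e₁ e₂ e₃
    intro a b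
    change S a b = 1 / 4
    cases a <;> cases b <;> linarith

/-! ### The error on random constraints -/

/-- The prefix `v` fixes a dyadic interval of length `2^q`, and the next coin chooses its lower or
upper half. -/
theorem randomBits_apply (q v k : ℕ) : randomBits q v k =
    if v * 2 ^ q ≤ k ∧ k < (v + 1) * 2 ^ q then ((2 : ENNReal) ^ q)⁻¹ else 0 := by
  induction q generalizing v with
  | zero =>
    rw [randomBits, PMF.pure_apply]
    have : k = v ↔ v * 2 ^ 0 ≤ k ∧ k < (v + 1) * 2 ^ 0 := by omega
    simp [this]
  | succ q ih =>
    rw [randomBits, PMF.bind_apply, tsum_fintype, Fintype.sum_bool, ih, ih]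
    simp only [PMF.uniformOfFintype_apply, Fintype.card_bool, Bool.toNat_true, Bool.toNat_false]
    have hpow : ((2 : ENNReal) ^ (q + 1))⁻¹ = ((2 : ℕ) : ENNReal)⁻¹ * ((2 : ENNReal) ^ q)⁻¹ := by
      rw [pow_succ', ENNReal.mul_inv (by simp) (by simp)]
      simp
    rw [hpow, pow_succ' (2 : ℕ)]
    generalize (2 : ℕ) ^ q = N
    have e₁ : (2 * v + 1) * N = 2 * (v * N) + N := by ring
    have e₂ : (2 * v + 1 + 1) * N = 2 * (v * N) + 2 * N := by ring
    have e₃ : (2 * v + 0) * N = 2 * (v * N) := by ring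
    have e₅ : v * (2 * N) = 2 * (v * N) := by ring
    have e₆ : (v + 1) * (2 * N) = 2 * (v * N) + 2 * N := by ring
    simp only [e₁, e₂, e₃, e₅, e₆]
    generalize v * N = M
    by_cases h₁ : 2 * M ≤ k ∧ k < 2 * M + N
    · rw [if_neg (by omega), if_pos h₁, if_pos (by omega), mul_zero, zero_add]
    · by_cases h₂ : 2 * M + N ≤ k ∧ k < 2 * M + 2 * N
      · rw [if_pos h₂, if_neg h₁, if_pos (by omega), mul_zero, add_zero]
      · rw [if_neg h₂, if_neg h₁, if_neg (by omega), mul_zero, add_zero]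

theorem randomBits_zero_eq (q : ℕ) :
    randomBits q 0 = PMF.uniformOfFinset (Finset.range (2 ^ q)) (by simp) := by
  ext k
  rw [randomBits_apply, PMF.uniformOfFinset_apply]
  simp

theorem count_headExample {K n : ℕ} (Cs : List (Constraint K n))
    (p : (Fin n → Bool) × Bool → Prop) [DecidablePred p] (r : ℕ) :
    Nat.count (fun v => p (headExample (Cs.drop v))) (Cs.length + r) =
      Cs.countP (fun C => p C.toExample) + if p (fun _ => false, false) then r else 0 := by
  induction Cs with
  | nil =>
    simp only [List.length_nil, zero_add, List.drop_nil, headExample, List.countP_nil]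
    split_ifs with h
    · simp [h]
    · simp [h]
  | cons C Cs ih =>
    rw [List.length_cons, add_right_comm, Nat.count_succ']
    simp only [List.drop_succ_cons, List.drop_zero, List.countP_cons, decide_eq_true_eq]
    rw [ih, add_right_comm]
    rfl

/-- The `2^q - m` padding indices count as errors only for hypotheses with `h 0 = true`. They never
hurt a parity and can only increase the error of another hypothesis, which gives `err_chi` and
`badCount_div_le_err`. -/
theorem err_drawDist {K n q : ℕ} (Cs : List (Constraint K n)) (hq : Cs.length ≤ 2 ^ q)
    (h : (Fin n → Bool) → Bool) :
    err (drawDist q Cs) h = ((Cs.countP (fun C => h C.toExample.1 ≠ C.toExample.2) +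
      if h (fun _ => false) ≠ false then 2 ^ q - Cs.length else 0 : ℕ) : ℝ) / 2 ^ q := by
  classical
  have h₁ := count_headExample Cs (fun z => h z.1 ≠ z.2) (2 ^ q - Cs.length)
  rw [Nat.add_sub_cancel' hq] at h₁
  rw [← h₁, Nat.count_eq_card_filter_range]
  rw [err, drawDist, PMF.toOuterMeasure_map_apply, randomBits_zero_eq,
    PMF.toOuterMeasure_uniformOfFinset_apply]
  simp only [Set.mem_preimage, Set.mem_ofPred_eq, Finset.card_range, ENNReal.toReal_div,
    ENNReal.toReal_natCast, Nat.cast_pow, Nat.cast_ofNat]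
  simp

/-! ### Counting -/

theorem countP_ofFn {α : Type*} {m : ℕ} (f : Fin m → α) (p : α → Prop) [DecidablePred p] :
    (List.ofFn f).countP (fun a => p a) = (Finset.univ.filter fun k => p (f k)).card := by
  induction m with
  | zero => simp
  | succ m ih =>
    rw [List.ofFn_succ, List.countP_cons, ih, Fin.card_filter_univ_succ]
    simp only [decide_eq_true_eq]
    split_ifs <;> rfl

theorem foldl_xor_not (a : Bool) (l : List Bool) : l.foldl xor (!a) = !l.foldl xor a := by
  induction l generalizing a with
  | nil => rfl
  | cons b l ih => rw [List.foldl_cons, Bool.not_xor, ih, List.foldl_cons]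

/-- The involution that changes the first sign of a constraint. -/
def flipSign {K n : ℕ} : Equiv.Perm (Constraint (K + 1) n) :=
  Function.Involutive.toPerm (fun C => (flip 0 C.1, C.2)) fun C => by
    simp [flip_flip]

theorem toExample_flipSign {K n : ℕ} (C : Constraint (K + 1) n) :
    (flipSign C).toExample = (C.toExample.1, !C.toExample.2) := by
  have : flipSign C = (flip 0 C.1, C.2) := rfl
  rw [this]
  simp only [Constraint.toExample, List.ofFn_succ, List.foldl_cons]
  refine Prod.ext rfl ?_
  simp only [flip, Function.update_self, ← foldl_xor_not]
  congr 1
  simp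

/-- Exponential Markov inequality. A correct constraint gets weight `4`, a wrong one `1`; `flipSign`
swaps the two cases, so the mean weight is `5/2`. With fewer than `m/4` errors the product of the
weights is at least `4^(3m/4) = 8^(m/2) ≥ (14/5)^m`, and `(5/2)/(14/5) = 25/28`. -/
theorem card_bad_le {K n m : ℕ} (hK : 0 < K) (h : (Fin n → Bool) → Bool) :
    ((Finset.univ.filter fun J : Instance K n m =>
      4 * (Finset.univ.filter fun k => h (J k).toExample.1 ≠ (J k).toExample.2).card < m).card : ℝ)
      ≤ (25 / 28) ^ m * Fintype.card (Instance K n m) := by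
  classical
  obtain ⟨K, rfl⟩ : ∃ K', K = K' + 1 := ⟨K - 1, by omega⟩
  set a : Constraint (K + 1) n → ℝ := fun C =>
    if h C.toExample.1 ≠ C.toExample.2 then 1 else 4 with ha
  have hsum : ∑ C, a C = 5 / 2 * Fintype.card (Constraint (K + 1) n) := by
    have h₁ : ∑ C, (a C + a (flipSign C)) = 5 * Fintype.card (Constraint (K + 1) n) := by
      rw [Finset.sum_congr rfl (g := fun _ => (5 : ℝ)), Finset.sum_const, nsmul_eq_mul,
        Finset.card_univ, mul_comm]
      intro C _
      simp only [ha, toExample_flipSign]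
      cases h C.toExample.1 <;> cases C.toExample.2 <;> norm_num
    rw [Finset.sum_add_distrib, Equiv.sum_comp] at h₁
    linarith
  have hprod : ∑ J : Instance (K + 1) n m, ∏ k, a (J k) =
      (5 / 2) ^ m * Fintype.card (Instance (K + 1) n m) := by
    rw [← Fintype.sum_pow, hsum, mul_pow]
    simp [Instance]
  set Bad := Finset.univ.filter fun J : Instance (K + 1) n m =>
      4 * (Finset.univ.filter fun k => h (J k).toExample.1 ≠ (J k).toExample.2).card < m with hBad
  have hle : ∀ J ∈ Bad, (14 / 5 : ℝ) ^ m ≤ ∏ k, a (J k) := by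
    intro J hJ
    rw [hBad, Finset.mem_filter] at hJ
    have h₁ := Finset.card_filter_add_card_filter_not (s := (Finset.univ : Finset (Fin m)))
      (fun k => h (J k).toExample.1 ≠ (J k).toExample.2)
    rw [Finset.card_univ, Fintype.card_fin] at h₁
    simp only [ha]
    rw [Finset.prod_ite, Finset.prod_const_one, one_mul, Finset.prod_const]
    set c := (Finset.univ.filter fun k =>
      ¬ h (J k).toExample.1 ≠ (J k).toExample.2).card with hc
    have h₂ : 3 * m ≤ 4 * c := by omega
    -- Squaring keeps the exponents integral although `3m/4` need not be; it rests on `(14/5)^2 =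
    -- 196/25 ≤ 8`.
    refine (pow_le_pow_iff_left₀ (by positivity) (by positivity) two_ne_zero).1 ?_
    calc ((14 / 5 : ℝ) ^ m) ^ 2 = (196 / 25) ^ m := by rw [pow_right_comm]; norm_num
      _ ≤ 8 ^ m := pow_le_pow_left₀ (by norm_num) (by norm_num) m
      _ = 2 ^ (3 * m) := by rw [pow_mul]; norm_num
      _ ≤ 2 ^ (4 * c) := pow_le_pow_right₀ (by norm_num) h₂
      _ = (4 ^ c) ^ 2 := by
        rw [show (4 : ℝ) = 2 ^ 2 by norm_num, ← pow_mul, ← pow_mul]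
        congr 1
        ring
  have h₁ : (Bad.card : ℝ) * (14 / 5) ^ m ≤
      (5 / 2) ^ m * Fintype.card (Instance (K + 1) n m) := by
    rw [← hprod, ← nsmul_eq_mul]
    refine (Finset.card_nsmul_le_sum _ _ _ hle).trans ?_
    refine Finset.sum_le_sum_of_subset_of_nonneg (Finset.subset_univ _) fun J _ _ => ?_
    refine Finset.prod_nonneg fun k _ => ?_
    simp only [ha]
    split_ifs <;> norm_num
  have h₂ : (25 / 28 : ℝ) ^ m * (14 / 5) ^ m = (5 / 2) ^ m := by
    rw [← mul_pow]; norm_num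
  rw [← h₂, mul_assoc, mul_comm ((14 / 5 : ℝ) ^ m), ← mul_assoc] at h₁
  exact le_of_mul_le_mul_right h₁ (by positivity)

/-! ### Polynomial bounds -/

def PolyBounded (e : ℕ) (f : ℕ → ℕ) : Prop := ∃ C : ℕ, ∀ n : ℕ, 1 ≤ n → f n ≤ C * n ^ e

namespace PolyBounded

variable {e e' : ℕ} {f g : ℕ → ℕ}

theorem mono (hf : PolyBounded e f) (he : e ≤ e') : PolyBounded e' f := by
  obtain ⟨C, hC⟩ := hf
  exact ⟨C, fun n hn => (hC n hn).trans (Nat.mul_le_mul_left _ (Nat.pow_le_pow_right hn he))⟩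

theorem of_le (hf : PolyBounded e f) (h : ∀ n, 1 ≤ n → g n ≤ f n) : PolyBounded e g := by
  obtain ⟨C, hC⟩ := hf
  exact ⟨C, fun n hn => (h n hn).trans (hC n hn)⟩

theorem const (c : ℕ) : PolyBounded 0 fun _ => c := ⟨c, fun n _ => by simp⟩

theorem id : PolyBounded 1 fun n => n := ⟨1, fun n _ => by simp⟩

theorem add (hf : PolyBounded e f) (hg : PolyBounded e' g) :
    PolyBounded (max e e') fun n => f n + g n := by
  obtain ⟨C, hC⟩ := hf.mono (le_max_left e e')
  obtain ⟨C', hC'⟩ := hg.mono (le_max_right e e')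
  exact ⟨C + C', fun n hn => by rw [add_mul]; exact add_le_add (hC n hn) (hC' n hn)⟩

theorem mul (hf : PolyBounded e f) (hg : PolyBounded e' g) :
    PolyBounded (e + e') fun n => f n * g n := by
  obtain ⟨C, hC⟩ := hf
  obtain ⟨C', hC'⟩ := hg
  refine ⟨C * C', fun n hn => (Nat.mul_le_mul (hC n hn) (hC' n hn)).trans_eq ?_⟩
  rw [pow_add]
  ring

theorem pow (hf : PolyBounded e f) (k : ℕ) : PolyBounded (e * k) fun n => f n ^ k := by
  obtain ⟨C, hC⟩ := hf
  refine ⟨C ^ k, fun n hn => (Nat.pow_le_pow_left (hC n hn) k).trans_eq ?_⟩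
  rw [mul_pow, pow_mul]

/-- The exponent is exactly `natDegree`, whatever the shift `c`. In the main argument `c` depends on
`d`, which is itself defined from this degree. -/
theorem eval (p : Polynomial ℕ) (c : ℕ) : PolyBounded p.natDegree fun n => p.eval (n + c) := by
  refine ⟨∑ i ∈ Finset.range (p.natDegree + 1), p.coeff i * (c + 1) ^ i, fun n hn => ?_⟩
  beta_reduce
  rw [Polynomial.eval_eq_sum_range, Finset.sum_mul]
  refine Finset.sum_le_sum fun i hi => ?_
  rw [mul_assoc]
  refine Nat.mul_le_mul_left _ ?_
  have h₁ : n + c ≤ (c + 1) * n := by nlinarith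
  refine (Nat.pow_le_pow_left h₁ i).trans ?_
  rw [mul_pow]
  refine Nat.mul_le_mul_left _ (Nat.pow_le_pow_right hn ?_)
  rw [Finset.mem_range] at hi
  omega

end PolyBounded

theorem le_two_pow_size (n d : ℕ) : n ^ d ≤ 2 ^ (d * n.size) := by
  rw [mul_comm, pow_mul]
  exact Nat.pow_le_pow_left (Nat.lt_size_self n).le d

/-- Rounding up to a power of two costs only the constant factor `2^d`, so a constant error
parameter compensates for the padding. -/
theorem two_pow_size_le {n : ℕ} (hn : 1 ≤ n) (d : ℕ) : 2 ^ (d * n.size) ≤ 2 ^ d * n ^ d := by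
  rw [mul_comm d, pow_mul, ← mul_pow]
  refine Nat.pow_le_pow_left ?_ d
  have h₁ : 0 < n.size := Nat.size_pos.2 hn
  have h₂ : 2 ^ (n.size - 1) ≤ n := Nat.lt_size.1 (by omega)
  calc 2 ^ n.size = 2 * 2 ^ (n.size - 1) := by rw [← pow_succ', Nat.sub_add_cancel h₁]
    _ ≤ 2 * n := Nat.mul_le_mul_left _ h₂

/-- Here only the existence of some exponent matters, so the exponents of the partial bounds are
hidden by existentials. -/
theorem exists_reductionTime_le (K W d s t : ℕ) (p : Polynomial ℕ) :
    ∃ p' : Polynomial ℕ, ∀ n, 1 ≤ n →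
      reductionTime K W d s t n (n ^ d) (p.eval (n + (s + t))) ≤ p'.eval n := by
  have hc := PolyBounded.const
  have hid := PolyBounded.id
  have hT := PolyBounded.eval p (s + t)
  have hm : PolyBounded _ fun n => n ^ d := hid.pow d
  have hpow : PolyBounded _ fun n => 2 ^ (d * n.size) :=
    ((hc (2 ^ d)).mul hm).of_le fun n hn => two_pow_size_le hn d
  have hq : PolyBounded _ fun n => d * n.size :=
    ((hc d).mul hid).of_le fun n _ => Nat.mul_le_mul_left _ (Nat.size_le.2 Nat.lt_two_pow_self)
  have hparse : ∃ e, PolyBounded e fun n => parseTime K n :=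
    ⟨_, (((hc 30).mul hid).add (hc 20)).add ((hc K).mul (((hc 20).mul hid).add (hc 41)))⟩
  obtain ⟨_, hparse⟩ := hparse
  have henc : ∃ e, PolyBounded e fun n => n ^ d * (K * (n + 2)) :=
    ⟨_, hm.mul ((hc K).mul (hid.add (hc 2)))⟩
  obtain ⟨_, henc⟩ := henc
  have hdraw : ∃ e, PolyBounded e fun n => drawTime K n (n ^ d) (d * n.size) :=
    ⟨_, ((((((hc 20).mul hq).add (hq.mul (((hc 25).mul hpow).add (hc 20)))).add
      ((hc 30).mul henc)).add ((hpow.add (hc 1)).mul (hparse.add (hc 3)))).add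
        ((hc 20).mul hid)).add (hc 100)⟩
  obtain ⟨_, hdraw⟩ := hdraw
  have hlen : ∃ e, PolyBounded e fun n => p.eval (n + (s + t)) * (n + 1) :=
    ⟨_, hT.mul (hid.add (hc 1))⟩
  obtain ⟨_, hlen⟩ := hlen
  have heval : ∃ e, PolyBounded e fun n => evalTime K n (n + p.eval (n + (s + t)) * (n + 1))
      (p.eval (n + (s + t))) W :=
    ⟨_, ((((hparse.add ((hc 20).mul (hid.add hlen))).add ((hc 20).mul hid)).add hT).add
      ((hc W).mul (((hc 2).mul (((hid.add hlen).add hid).add hT)).add (hc 3)))).add (hc 60)⟩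
  obtain ⟨_, heval⟩ := heval
  have htotal : ∃ e, PolyBounded e fun n =>
      reductionTime K W d s t n (n ^ d) (p.eval (n + (s + t))) :=
    ⟨_, (((((((((((((hc 16).mul hid).add (hid.mul ((((hc 20).mul hid).add (hc (2 * d))).add
      (hc 10)))).add (hc (2 * s))).add (hc (2 * t))).add (hT.mul (hdraw.add (hc 1)))).add
      ((hc 16).mul (hid.add hlen))).add ((hc W).mul (((hc 2).mul
        (((hid.add (hc s)).add (hc t)).add hlen)).add (hc 3)))).add ((hc 20).mul henc)).add
      (hm.mul (heval.add (hc 1)))).add ((hc 10).mul hm)).add ((hc 2).mul hid)).add (hc 100))⟩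
  obtain ⟨e, C, hC⟩ := htotal
  exact ⟨Polynomial.C C * Polynomial.X ^ e, fun n hn => by simpa using hC n hn⟩

/-! ### Union bound over descriptions of hypotheses. -/

/-- The number of constraints on which a hypothesis errs. -/
def badCount {K n m : ℕ} (J : Instance K n m) (h : (Fin n → Bool) → Bool) : ℕ :=
  (Finset.univ.filter fun k => h (J k).toExample.1 ≠ (J k).toExample.2).card

/-- No description of length at most `B` belongs to a hypothesis that errs on less than a quarter of
the constraints. -/
def NoFit {K n m : ℕ} (E : Prog Empty) (T B : ℕ) (J : Instance K n m) : Prop :=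
  ∀ w : List Bool, w.length ≤ B → ∀ h : (Fin n → Bool) → Bool, Describes E T w h →
    m ≤ 4 * badCount J h

/-- There are fewer than `2^(B+1)` bit strings of length at most `B`, and each describes at most one
hypothesis, to which `card_bad_le` applies. -/
theorem ncard_fit_le {K n m : ℕ} (hK : 0 < K) (E : Prog Empty) (T B : ℕ) :
    ({J : Instance K n m | ¬ NoFit E T B J}.ncard : ℝ) ≤
      2 ^ (B + 1) * ((25 / 28) ^ m * Fintype.card (Instance K n m)) := by
  classical
  -- Strings that describe nothing get a dummy hypothesis, which only enlarges the union.
  set h : List Bool → (Fin n → Bool) → Bool := fun w =>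
    if hw : ∃ h : (Fin n → Bool) → Bool, Describes E T w h then hw.choose else fun _ => false
    with hh
  have hspec : ∀ w h', Describes E T w h' → h w = h' := by
    intro w h' hw
    have hex : ∃ h : (Fin n → Bool) → Bool, Describes E T w h := ⟨h', hw⟩
    simp only [hh, dif_pos hex]
    exact hex.choose_spec.unique hw
  set Bad : List Bool → Finset (Instance K n m) := fun w =>
    Finset.univ.filter fun J => 4 * badCount J (h w) < m
  set U : Finset (Instance K n m) := (Finset.range (B + 1)).biUnion fun l =>
    (Finset.univ : Finset (Fin l → Bool)).biUnion fun v => Bad (List.ofFn v) with hU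
  have hsub : {J : Instance K n m | ¬ NoFit E T B J} ⊆ (U : Set (Instance K n m)) := by
    intro J hJ
    simp only [NoFit, Set.mem_ofPred_eq, not_forall, not_le] at hJ
    obtain ⟨w, hw, h', hd, hlt⟩ := hJ
    rw [← hspec w h' hd] at hlt
    simp only [hU, Finset.coe_biUnion, Set.mem_iUnion, Finset.mem_coe]
    refine ⟨w.length, by simpa [Nat.lt_succ_iff] using hw, w.get, Finset.mem_univ _, ?_⟩
    rw [List.ofFn_get]
    exact Finset.mem_filter.2 ⟨Finset.mem_univ _, hlt⟩
  have h₁ : ({J : Instance K n m | ¬ NoFit E T B J}.ncard : ℝ) ≤ U.card := by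
    rw [← Set.ncard_coe_finset]
    exact_mod_cast Set.ncard_le_ncard hsub (Finset.finite_toSet _)
  refine h₁.trans ?_
  set c : ℝ := (25 / 28) ^ m * Fintype.card (Instance K n m) with hc
  have h₂ : ∀ l, (((Finset.univ : Finset (Fin l → Bool)).biUnion fun v =>
      Bad (List.ofFn v)).card : ℝ) ≤ 2 ^ l * c := by
    intro l
    refine (Nat.cast_le.2 Finset.card_biUnion_le).trans ?_
    rw [Nat.cast_sum]
    refine (Finset.sum_le_card_nsmul _ _ c fun v _ => card_bad_le hK _).trans_eq ?_
    simp
  refine (Nat.cast_le.2 Finset.card_biUnion_le).trans ?_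
  rw [Nat.cast_sum]
  refine (Finset.sum_le_sum fun l _ => h₂ l).trans ?_
  rw [← Finset.sum_mul]
  refine mul_le_mul_of_nonneg_right ?_ (by positivity)
  rw [geom_sum_eq (by norm_num)]
  norm_num

/-! ### Correctness of the reduction -/

theorem countP_eq_badCount {K n m : ℕ} (J : Instance K n m) (h : (Fin n → Bool) → Bool) :
    (List.ofFn J).countP (fun C => h C.toExample.1 ≠ C.toExample.2) = badCount J h :=
  countP_ofFn J fun C => h C.toExample.1 ≠ C.toExample.2

theorem countP_eq_sub_badCount {K n m : ℕ} (J : Instance K n m) (h : (Fin n → Bool) → Bool) :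
    (List.ofFn J).countP (fun C => h C.toExample.1 = C.toExample.2) = m - badCount J h := by
  rw [countP_ofFn J fun C => h C.toExample.1 = C.toExample.2, badCount]
  have := Finset.card_filter_add_card_filter_not (s := (Finset.univ : Finset (Fin m)))
    (fun k => h (J k).toExample.1 = (J k).toExample.2)
  rw [Finset.card_univ, Fintype.card_fin] at this
  simp only [ne_eq]
  omega

theorem badCount_le {K n m : ℕ} (J : Instance K n m) (h : (Fin n → Bool) → Bool) :
    badCount J h ≤ m :=
  (Finset.card_filter_le _ _).trans (by simp)

theorem badCount_div_le_err {K n m q : ℕ} (J : Instance K n m) (hq : m ≤ 2 ^ q)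
    (h : (Fin n → Bool) → Bool) :
    (badCount J h : ℝ) / 2 ^ q ≤ err (drawDist q (List.ofFn J)) h := by
  rw [err_drawDist _ (by simpa using hq), countP_eq_badCount]
  gcongr
  omega

theorem err_chi {K n m q : ℕ} (J : Instance K n m) (hq : m ≤ 2 ^ q) (S : Finset (Fin n)) :
    err (drawDist q (List.ofFn J)) (chi S) = (badCount J (chi S) : ℝ) / 2 ^ q := by
  rw [err_drawDist _ (by simpa using hq), countP_eq_badCount]
  simp [chi]

theorem errClass_le {n : ℕ} (D : PMF ((Fin n → Bool) × Bool)) (S : Finset (Fin n)) :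
    errClass D (PARITY n) ≤ err D (chi S) :=
  csInf_le ⟨0, by rintro _ ⟨h, -, rfl⟩; exact ENNReal.toReal_nonneg⟩ ⟨chi S, ⟨S, rfl⟩, rfl⟩

theorem exists_badCount_le {K n m : ℕ} (hm : 0 < m) (J : Instance K n m) {ε : ℝ}
    (hJ : 1 - ε ≤ value (chi Finset.univ) J) : ∃ S, (badCount J (chi S) : ℝ) ≤ ε * m := by
  obtain ⟨x, hx⟩ := exists_eq_ciSup_of_finite (f := fun x : Fin n → Bool =>
    ((Finset.univ.filter fun k : Fin m => (J k).eval (chi Finset.univ) x = true).card : ℝ) / m)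
  rw [value, ← hx, le_div_iff₀ (by positivity)] at hJ
  simp only [eval_eq_true_iff] at hJ
  refine ⟨Finset.univ.filter fun i => x i = true, ?_⟩
  have h₁ := Finset.card_filter_add_card_filter_not (s := (Finset.univ : Finset (Fin m)))
    (fun k => chi (Finset.univ.filter fun i => x i = true) (J k).toExample.1 =
      (J k).toExample.2)
  rw [Finset.card_univ, Fintype.card_fin] at h₁
  have h₂ : ((Finset.univ.filter fun k => chi (Finset.univ.filter fun i => x i = true)
      (J k).toExample.1 = (J k).toExample.2).card : ℝ) +
        badCount J (chi (Finset.univ.filter fun i => x i = true)) = m := mod_cast h₁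
  linarith

/-- A hypothesis that satisfies the guarantee of the learning algorithm for the distribution of
random constraints is correct on more than three quarters of the constraints. -/
theorem badCount_lt {K n m d : ℕ} {α : ℝ} (hα : 1 ≤ α) (hm : 0 < m) (J : Instance K n m) {q : ℕ}
    (hq : m ≤ 2 ^ q) (hq' : 2 ^ q ≤ 2 ^ d * m) {h : (Fin n → Bool) → Bool}
    (hJ : 1 - 1 / (10 * α) ≤ value (chi Finset.univ) J)
    (hh : err (drawDist q (List.ofFn J)) h ≤
      α * errClass (drawDist q (List.ofFn J)) (PARITY n) + 1 / ((20 * 2 ^ d : ℕ) : ℝ)) :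
    4 * badCount J h < m := by
  obtain ⟨S, hS⟩ := exists_badCount_le hm J hJ
  have h₁ := (badCount_div_le_err J hq h).trans (hh.trans (add_le_add_left
    (mul_le_mul_of_nonneg_left (errClass_le _ S) (by linarith)) _))
  rw [err_chi J hq, div_le_iff₀ (by positivity), add_mul, mul_assoc,
    div_mul_cancel₀ _ (by positivity)] at h₁
  -- Scaled by `2^q`, the guarantee allows `α · m/(10α) = m/10` errors from the best parity and at
  -- most `m/20` from the additive term. The total `3m/20` is below `m/4`.
  have h₂ : α * (badCount J (chi S) : ℝ) ≤ m / 10 := by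
    refine (mul_le_mul_of_nonneg_left hS (by linarith)).trans_eq ?_
    field_simp
  have h₃ : 1 / ((20 * 2 ^ d : ℕ) : ℝ) * 2 ^ q ≤ m / 20 := by
    have : (2 : ℝ) ^ q ≤ 2 ^ d * m := mod_cast hq'
    push_cast
    rw [div_mul_eq_mul_div, one_mul, div_le_div_iff₀ (by positivity) (by norm_num)]
    linarith
  have h₄ : (0 : ℝ) < m := by exact_mod_cast hm
  have h₅ : (4 * badCount J h : ℝ) < m := by linarith
  exact_mod_cast h₅

/-- Transfer principle: an event of the learner's run on which the described hypothesis dictates the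
answer `b` bounds the probability of `b` from below. It serves for the success event with `b =
true`, and for the sure event with `b = false`. -/
theorem runs_reduction_instance {K n m W : ℕ} (hK : 0 < K) (d s t T : ℕ) {L : Prog LearnQuery}
    {E : Prog Empty} (hW : 3 ≤ W) (hLW : regBound L ≤ W) (hEW : regBound E ≤ W)
    (J : Instance K n m)
    (hL : HaltsWithin (learnOracle (drawDist (d * n.size) (List.ofFn J))) L
      [unary n, unary s, unary t] T)
    (hE : ∀ c ∈ (exec (learnOracle (drawDist (d * n.size) (List.ofFn J))) L
      [unary n, unary s, unary t] T).support,
        ∃ h : (Fin n → Bool) → Bool, Describes E T (output c) h)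
    {t' : ℕ} (ht' : reductionTime K W d s t n m T ≤ t') :
    HaltsWithin coinOracle (reduction K W d s t L E) [unary n, encodeInstance J] t' ∧
    ∀ (b : Bool) (A : Set (Config LearnQuery)),
      (∀ c ∈ (exec (learnOracle (drawDist (d * n.size) (List.ofFn J))) L
        [unary n, unary s, unary t] T).support, c ∈ A →
          ∃ h : (Fin n → Bool) → Bool, Describes E T (output c) h ∧
            decide (4 * badCount J h < m) = b) →
      (exec (learnOracle (drawDist (d * n.size) (List.ofFn J))) L
        [unary n, unary s, unary t] T).toOuterMeasure A ≤
          answerProb (reduction K W d s t L E) t' J b := by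
  obtain ⟨g, hg₁, hg₂⟩ := runs_reduction hK d s t T hW hLW hEW (List.ofFn J) hL hE
  rw [List.length_ofFn] at hg₁
  have hexec := hg₁.exec_eq ht'
  rw [← encodeInstance_eq] at hexec
  refine ⟨fun c hc => ?_, fun b A hA => ?_⟩
  · rw [hexec, PMF.mem_support_map_iff] at hc
    obtain ⟨_, -, rfl⟩ := hc
    rfl
  · rw [answerProb, hexec, PMF.toOuterMeasure_map_apply, PMF.toOuterMeasure_map_apply]
    refine PMF.toOuterMeasure_mono _ ?_
    rintro c ⟨hcA, hc⟩
    obtain ⟨h, hh, rfl⟩ := hA c hc hcA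
    refine ⟨rfl, ?_⟩
    change g c 0 = _
    rw [hg₂ c hc h hh, countP_eq_badCount, countP_eq_sub_badCount]
    -- This makes the subtraction in `m - badCount J h` exact, so that `3 * bad < m - bad` becomes
    -- `4 * bad < m`.
    have := badCount_le J h
    congr 2
    rw [eq_iff_iff]
    omega

/-- The description length `B` is of order `n^(deg p + 1)`, one power below `m`. So eventually `m ≥
7(B + 1 + n)`, and `(25/28)^7 ≤ 1/2` leaves a fraction of at most `2^(-n)` exceptional instances. -/
theorem tendsto_noFit {K : ℕ} (hK : 0 < K) (E : Prog Empty) (p : Polynomial ℕ) (c : ℕ)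
    (S : ∀ n, Set (Instance K n (n ^ (p.natDegree + 2))))
    (hS : ∀ n, 1 ≤ n → ∀ J, NoFit E (p.eval (n + c)) (n + p.eval (n + c) * (n + 1)) J → J ∈ S n) :
    Filter.Tendsto (fun n : ℕ => ((S n).ncard : ℝ) /
      (Nat.card (Instance K n (n ^ (p.natDegree + 2))) : ℝ)) Filter.atTop (𝓝 1) := by
  have hpoly : PolyBounded (p.natDegree + 1)
      fun n => n + p.eval (n + c) * (n + 1) + 1 + n :=
    (((PolyBounded.id.add ((PolyBounded.eval p c).mul (PolyBounded.id.add
      (PolyBounded.const 1)))).add (PolyBounded.const 1)).add PolyBounded.id).mono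
        (by simp)
  obtain ⟨C, hC⟩ := hpoly
  have hlow : Filter.Tendsto (fun n : ℕ => 1 - (1 / 2 : ℝ) ^ n) Filter.atTop (𝓝 1) := by
    simpa using (tendsto_pow_atTop_nhds_zero_of_lt_one (r := (1 / 2 : ℝ)) (by norm_num)
      (by norm_num)).const_sub 1
  refine tendsto_of_tendsto_of_tendsto_of_le_of_le' hlow tendsto_const_nhds ?_ ?_
  · filter_upwards [Filter.eventually_ge_atTop (7 * C), Filter.eventually_ge_atTop K,
      Filter.eventually_ge_atTop 1] with n hn hnK hn1
    set m := n ^ (p.natDegree + 2) with hm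
    set B := n + p.eval (n + c) * (n + 1) with hB
    -- For `n < K` there are no constraints and the fraction may be `0/0`; hence the restriction to
    -- `n ≥ K`.
    have hne : Nonempty (Instance K n m) := ⟨fun _ => (fun _ => false, Fin.castLEEmb hnK)⟩
    have hcard : (0 : ℝ) < Nat.card (Instance K n m) := by exact_mod_cast Nat.card_pos
    have hmB : 7 * (B + 1 + n) ≤ m := by
      calc 7 * (B + 1 + n) ≤ 7 * (C * n ^ (p.natDegree + 1)) := Nat.mul_le_mul_left _ (hC n hn1)
        _ = 7 * C * n ^ (p.natDegree + 1) := by ring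
        _ ≤ n * n ^ (p.natDegree + 1) := Nat.mul_le_mul_right _ hn
        _ = m := by rw [hm]; ring
    have hbad := ncard_fit_le (n := n) (m := m) hK E (p.eval (n + c)) B
    rw [← Nat.card_eq_fintype_card] at hbad
    have hfrac : (2 : ℝ) ^ (B + 1) * (25 / 28) ^ m ≤ (1 / 2) ^ n := by
      calc (2 : ℝ) ^ (B + 1) * (25 / 28) ^ m
          ≤ 2 ^ (B + 1) * (25 / 28) ^ (7 * (B + 1 + n)) := by
            refine mul_le_mul_of_nonneg_left ?_ (by positivity)
            exact pow_le_pow_of_le_one (by norm_num) (by norm_num) hmB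
        _ ≤ 2 ^ (B + 1) * (1 / 2) ^ (B + 1 + n) := by
            refine mul_le_mul_of_nonneg_left ?_ (by positivity)
            rw [pow_mul]
            exact pow_le_pow_left₀ (by positivity) (by norm_num) _
        _ = (1 / 2) ^ n := by
            rw [pow_add (1 / 2 : ℝ), ← mul_assoc, ← mul_pow]
            norm_num
    have hsplit := Set.ncard_add_ncard_compl {J : Instance K n m | NoFit E (p.eval (n + c)) B J}
    have hsub : ({J : Instance K n m | NoFit E (p.eval (n + c)) B J}).ncard ≤ (S n).ncard :=
      Set.ncard_le_ncard (fun J hJ => hS n hn1 J hJ) (Set.toFinite _)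
    rw [le_div_iff₀ hcard]
    have h₁ : ((S n).ncard : ℝ) + ({J : Instance K n m | ¬ NoFit E (p.eval (n + c)) B J}).ncard ≥
        Nat.card (Instance K n m) := by
      rw [← hsplit]
      rw [Nat.cast_add]
      exact add_le_add (Nat.cast_le.2 hsub) le_rfl
    have h₂ : (2 : ℝ) ^ (B + 1) * ((25 / 28) ^ m * (Nat.card (Instance K n m))) ≤
        (1 / 2) ^ n * Nat.card (Instance K n m) := by
      rw [← mul_assoc]
      exact mul_le_mul_of_nonneg_right hfrac hcard.le
    linarith
  · filter_upwards with n
    refine div_le_one_of_le₀ ?_ (Nat.cast_nonneg _)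
    exact_mod_cast Set.ncard_le_card _

/-! ### Choice of parameters and conclusion. -/

theorem not_SRCSPPart2For_parityPredicates {α : ℝ} (hα : 1 ≤ α)
    (hlearn : EfficientlyAgnosticallyLearnable PARITY α) :
    ¬ SRCSPPart2For parityPredicates := by
  rintro ⟨f, hf⟩
  obtain ⟨L, E, p, hp⟩ := hlearn
  -- No circularity: `d` depends only on the learner, `K` on `f d`, and the constant `s` on `d`. One
  -- power of `n` pays for the output length per step, the other makes `m` dominate.
  set d := p.natDegree + 2 with hd
  set K := max 3 (f d) with hK
  have hK3 : 3 ≤ K := le_max_left _ _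
  have hK0 : 0 < K := by omega
  -- The additive error `1/s` becomes at most `m/20` constraints, as `2^q ≤ 2^d * m`. The confidence
  -- parameter `4` will match the required probability `3/4`.
  set s := 20 * 2 ^ d with hs
  have hs2 : 2 ≤ s := by
    have := Nat.one_le_two_pow (n := d)
    omega
  -- `W` covers all registers of `L` and `E`, and the three inputs of the learner.
  set W := max 3 (max (regBound L) (regBound E)) with hW
  refine hf d (by omega) K (chi Finset.univ) rfl (exists_chi_true hK0) ⟨_, chi_false⟩
    ((le_max_right _ _).trans (le_VAR0_chi K)) (1 / (10 * α)) (by positivity) ?_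
  obtain ⟨p', hp'⟩ := exists_reductionTime_le K W d s 4 p
  have hrun := fun (n : ℕ) (hn : 1 ≤ n) (J : Instance K n (n ^ d)) =>
    runs_reduction_instance hK0 d s 4 (p.eval (n + (s + 4))) (W := W) (le_max_left _ _)
      ((le_max_left _ _).trans (le_max_right _ _)) ((le_max_right _ _).trans (le_max_right _ _)) J
      (by
        have := (hp n s 4 hn hs2 (by norm_num) (drawDist (d * n.size) (List.ofFn J))).1
        rwa [add_assoc] at this)
      (by
        have := (hp n s 4 hn hs2 (by norm_num) (drawDist (d * n.size) (List.ofFn J))).2.1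
        rwa [add_assoc] at this)
      (hp' n hn)
  refine ⟨reduction K W d s 4 L E, p', fun n hn J => (hrun n hn J).1, fun n hn J hJ => ?_, ?_⟩
  · have h₁ := (hp n s 4 hn hs2 (by norm_num) (drawDist (d * n.size) (List.ofFn J))).2.2
    rw [add_assoc] at h₁
    have h₂ : (3 / 4 : ENNReal) = ENNReal.ofReal (1 - 1 / ((4 : ℕ) : ℝ)) := by
      rw [show (1 - 1 / ((4 : ℕ) : ℝ)) = 3 / 4 by norm_num,
        ENNReal.ofReal_div_of_pos (by norm_num)]
      simp
    rw [h₂]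
    refine h₁.trans ((hrun n hn J).2 true _ ?_)
    rintro c - ⟨h, hh, herr⟩
    refine ⟨h, hh, ?_⟩
    rw [decide_eq_true_eq]
    refine badCount_lt hα (by positivity) J (le_two_pow_size n d) (two_pow_size_le hn d) ?_ herr
    -- Since `Uval` is at least `1`, an instance of value at least `Uval - ε` has value at least `1
    -- - ε`.
    exact (sub_le_sub_right (one_le_Uval_chi hK3) _).trans hJ
  · refine tendsto_noFit hK0 E p (s + 4) _ fun n hn J hJ => ?_
    -- If no short description fits `J`, every possible output of the learner fails the test, so the
    -- answer is `false` with probability `1`; the accuracy guarantee plays no role here.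
    have h₁ := (hrun n hn J).2 false Set.univ fun c hc _ => by
      have h₂ := (hp n s 4 hn hs2 (by norm_num) (drawDist (d * n.size) (List.ofFn J))).2.1
      rw [add_assoc] at h₂
      obtain ⟨h, hh⟩ := h₂ c hc
      refine ⟨h, hh, ?_⟩
      rw [decide_eq_false_iff_not, not_lt]
      exact hJ _ (length_output_le hc) h hh
    rw [(PMF.toOuterMeasure_apply_eq_one_iff _ _).2 (Set.subset_univ _)] at h₁
    refine le_trans ?_ h₁
    exact ENNReal.div_le_of_le_mul (by norm_num)

theorem SRCSPPart2For.mono {F F' : ∀ K : ℕ, Set ((Fin K → Bool) → Bool)} (hF : ∀ K, F K ⊆ F' K)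
    (h : SRCSPPart2For F') : SRCSPPart2For F := by
  obtain ⟨f, hf⟩ := h
  exact ⟨f, fun d hd K P hP => hf d hd K P (hF K hP)⟩

end ParityHard

end

theorem mainTheorem8 (α : ℝ) (hα : 1 ≤ α) :
    (ParityHard.EfficientlyAgnosticallyLearnable ParityHard.PARITY α →
      ¬ ParityHard.SRCSPPart2) ∧
    (ParityHard.EfficientlyAgnosticallyLearnable ParityHard.PARITY α →
      ¬ ParityHard.SRCSPPart2For ParityHard.parityPredicates) :=
  ⟨fun h h' => ParityHard.not_SRCSPPart2For_parityPredicates hα h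
    (h'.mono fun _ => Set.subset_univ _),
    ParityHard.not_SRCSPPart2For_parityPredicates hα⟩
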